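/- Let $B=(V,E)$ be a Bratteli diagram with $V_0=\{v_0\}$ a single vertex and $|V_n|=k$ for all $n\ge 1$, where $k\ge 2$ is fixed; identify $V_n$ with $\{1,\dots,k\}$ for $n\ge 1$. (So the edge set is a disjoint union of finite sets $E_n$, $n\ge1$, where every edge in $E_n$ goes from its source in $V_{n-1}$ to its range in $V_n$, every vertex is the source of some edge, and every vertex other than $v_0$ is the range of some edge.) For $n\ge 1$ let $F_n=(f^{(n)}_{i,j})$ be the $k\times k$ incidence matrix, $f^{(n)}_{i,j}$ being the number of edges from $j\in V_n$ to $i\in V_{n+1}$. Assume that for every $n\ge 1$ there is an integer $r_n\ge 2$ with $\sum_{j\in V_n} f^{(n)}_{i,j}=r_n$ for every $i\in V_{n+1}$, and that $\operatorname{rank}F_n=k$. Put $$ z^{(n)}=\det\begin{pmatrix} \dfrac{f^{(n)}_{1,1}}{r_n}&\cdots&\dfrac{f^{(n)}_{1,k-1}}{r_n}&1\\ \vdots&\ddots&\vdots&\vdots\\ \dfrac{f^{(n)}_{k,1}}{r_n}&\cdots&\dfrac{f^{(n)}_{k,k-1}}{r_n}&1 \end{pmatrix}. $$ Let $X_B$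 be the space of infinite paths starting at $v_0$, with the topology generated by cylinder sets, and let $\mathcal E$ be the tail equivalence relation on $X_B$ (two paths are equivalent if their edges agree from some index on). A Borel probability measure $\mu$ on $X_B$ is invariant if every Borel automorphism $T$ of $X_B$ with $(x,Tx)\in\mathcal E$ for all $x$ preserves $\mu$, and it is ergodic if every $\mathcal E$-saturated Borel set has measure $0$ or $1$. Then there are exactly $k$ ergodic invariant Borel probability measures on $X_B$ if and only if $$\prod_{n=1}^{\infty}|z^{(n)}|>0$$ (that is, the partial products converge to a positive limit), or, equivalently, if and only if $$\sum_{n=1}^{\infty}\bigl(1-|z^{(n)}|\bigr)<\infty .$$ -/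

import Mathlib

open Filter Topology MeasureTheory

universe u v

/-- A Bratteli diagram. `V n` is the `n`-th vertex set, and `E n` is the set of edges between
`V n` and `V (n + 1)` (the set usually written with index `n + 1`). -/
structure BratteliDiagram where
  V : ℕ → Type u
  E : ℕ → Type v
  fintypeV : ∀ n, Fintype (V n)
  finiteE : ∀ n, Finite (E n)
  root : V 0
  eq_root : ∀ w : V 0, w = root
  s : ∀ n, E n → V n
  r : ∀ n, E n → V (n + 1)
  s_surjective : ∀ n, Function.Surjective (s n)
  r_surjective : ∀ n, Function.Surjective (r n)

namespace BratteliDiagram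

attribute [instance] BratteliDiagram.fintypeV BratteliDiagram.finiteE

/-- The `n`-th incidence matrix: the `(v, w)` entry, for `v` in `V (n + 1)` and `w` in `V n`,
is the number of edges with range `v` and source `w`. -/
noncomputable def incidence (B : BratteliDiagram.{u, v}) (n : ℕ) :
    Matrix (B.V (n + 1)) (B.V n) ℕ :=
  Matrix.of fun v w => Nat.card {e : B.E n // B.r n e = v ∧ B.s n e = w}

/-- The space of infinite paths starting at the root. -/
def Path (B : BratteliDiagram.{u, v}) : Type v :=
  {x : ∀ n, B.E n // ∀ n, B.r n (x n) = B.s (n + 1) (x (n + 1))}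

/-- The cylinder set of all paths whose first `n` edges are those of `x`. Every finite path
extends to an infinite one, so these are all the cylinder sets. -/
def cylinder (B : BratteliDiagram.{u, v}) (x : B.Path) (n : ℕ) : Set B.Path :=
  {y | ∀ i < n, y.1 i = x.1 i}

/-- The topology on the path space generated by the cylinder sets. -/
instance (B : BratteliDiagram.{u, v}) : TopologicalSpace B.Path :=
  TopologicalSpace.generateFrom {A | ∃ x n, A = B.cylinder x n}

instance (B : BratteliDiagram.{u, v}) : MeasurableSpace B.Path := borel B.Path

instance (B : BratteliDiagram.{u, v}) : BorelSpace B.Path := ⟨rfl⟩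

/-- Tail equivalence of infinite paths. -/
def TailEquiv (B : BratteliDiagram.{u, v}) (x y : B.Path) : Prop :=
  ∃ n, ∀ i, n ≤ i → x.1 i = y.1 i

/-- Invariance of a Borel measure under the (countable Borel) tail equivalence relation:
every Borel automorphism of the path space that moves each path within its tail equivalence
class preserves the measure. -/
def IsTailInvariant (B : BratteliDiagram.{u, v}) (μ : Measure B.Path) : Prop :=
  ∀ T : B.Path ≃ᵐ B.Path, (∀ x, B.TailEquiv x (T x)) → MeasurePreserving T μ μ

/-- Ergodicity with respect to the tail equivalence relation: every Borel set that is a union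
of tail equivalence classes is null or co-null. -/
def IsTailErgodic (B : BratteliDiagram.{u, v}) (μ : Measure B.Path) : Prop :=
  ∀ A : Set B.Path, MeasurableSet A → (∀ x y, B.TailEquiv x y → (x ∈ A ↔ y ∈ A)) →
    μ A = 0 ∨ μ Aᶜ = 0

/-- The set of ergodic invariant probability measures of the diagram. -/
def ergodicMeasures (B : BratteliDiagram.{u, v}) : Set (Measure B.Path) :=
  {μ | IsProbabilityMeasure μ ∧ B.IsTailInvariant μ ∧ B.IsTailErgodic μ}

/-- The determinant attached to the incidence matrix of index `n + 1`, where
`σ m` identifies `V (m + 1)` with `{1, …, k}` and `ρ` is the row sum: the first `k - 1` columns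
are those of the incidence matrix divided by `ρ`, and all entries of the last column are `1`. -/
noncomputable def zDet (B : BratteliDiagram.{u, v}) {k : ℕ} (σ : ∀ n, B.V (n + 1) ≃ Fin k)
    (n ρ : ℕ) : ℝ :=
  Matrix.det (Matrix.of fun i j : Fin k =>
    if (j : ℕ) + 1 = k then (1 : ℝ)
    else (B.incidence (n + 1) ((σ (n + 1)).symm i) ((σ n).symm j) : ℝ) / (ρ : ℝ))

end BratteliDiagram

/-! Invariance means that the measure of a cylinder depends only on its terminal vertex
(`isTailInvariant_iff`). An invariant measure is thus a sequence of nonnegative vectors, one per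
level. Multiplied by the product of the row sums so far, these vectors are related by row-stochastic
matrices: `q 0 = q n * S n`, with `S n` the product `stochProd` (`massVec_zero_eq`). Each stochastic
factor has determinant `z` (`det_stochMatrix`), of absolute value in `(0, 1]`. So both criteria say
that `|det (S n)|` stays away from zero.

Since `S n` is invertible, the level-one vector in `ℝ^k` determines the measure
(`eq_of_massVec_eq`). Distinct ergodic measures live on disjoint saturated sets, hence have
independent vectors (`linearIndependent_massVec`), and there are at most `k` of them. If there are
`k`, their vectors form an invertible `P = Q * S n`. Stochasticity preserves coordinate sums, so the
rows of `Q` have sum at most one, `|det Q| ≤ 1` and `|det (S n)| ≥ |det P|`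
(`exists_le_abs_det_stochProd`).

Conversely, the uniform measure on the paths sharing a tail through the vertex `i` of level `n + 1`
has a mass vector there supported at `i`. Its level-one vector is therefore a multiple, bounded
below, of row `i` of `S n`. Limits along an ultrafilter give `k` invariant measures, independent
when `|det (S n)|` is bounded below. The same limit makes every invariant measure a nonnegative
combination of them, so they are ergodic (`mem_ergodicMeasures_of_cone`,
`le_encard_ergodicMeasures`). -/

namespace BratteliDiagram

/-! ### Paths, cylinder sets and the topology of the path space. -/

variable (B : BratteliDiagram.{u, v})

theorem nonempty_edge (n : ℕ) : Nonempty (B.E n) := by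
  induction n with
  | zero => obtain ⟨e, -⟩ := B.s_surjective 0 B.root; exact ⟨e⟩
  | succ n ih => obtain ⟨e, -⟩ := B.s_surjective (n + 1) (B.r n ih.some); exact ⟨e⟩

theorem exists_path_extending (M : ℕ) (u : ∀ n, B.E n)
    (hu : ∀ i < M, B.r i (u i) = B.s (i + 1) (u (i + 1))) :
    ∃ w : B.Path, ∀ i ≤ M, w.1 i = u i := by
  choose f hf using fun n => B.s_surjective (n + 1)
  let w : ∀ n, B.E n := fun n => Nat.rec (u 0)
    (fun n e => if n + 1 ≤ M then u (n + 1) else f n (B.r n e)) n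
  have hw : ∀ n, w (n + 1) = if n + 1 ≤ M then u (n + 1) else f n (B.r n (w n)) := fun n => rfl
  have key : ∀ i ≤ M, w i = u i := by
    intro i hi
    cases i with
    | zero => rfl
    | succ i => rw [hw, if_pos hi]
  refine ⟨⟨w, fun n => ?_⟩, key⟩
  by_cases h : n + 1 ≤ M
  · rw [key n (by omega), key (n + 1) h, hu n (by omega)]
  · rw [hw, if_neg h, hf]

theorem exists_path_edge (m : ℕ) (e : B.E m) : ∃ z : B.Path, z.1 m = e := by
  induction m with
  | zero =>
    obtain ⟨w, hw⟩ := B.exists_path_extending 0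
      (Function.update (fun n => (B.nonempty_edge n).some) 0 e) (by simp)
    exact ⟨w, by simpa using hw 0 le_rfl⟩
  | succ m ih =>
    obtain ⟨e', he'⟩ := B.r_surjective m (B.s (m + 1) e)
    obtain ⟨z, hz⟩ := ih e'
    obtain ⟨w, hw⟩ := B.exists_path_extending (m + 1) (Function.update z.1 (m + 1) e) (by
      intro i hi
      rw [Function.update_of_ne (by omega)]
      rcases Nat.lt_succ_iff_lt_or_eq.1 hi with h | rfl
      · rw [Function.update_of_ne (by omega), z.2]
      · rw [Function.update_self, hz, he'])
    exact ⟨w, by simpa using hw (m + 1) le_rfl⟩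

instance : Nonempty B.Path := by
  obtain ⟨e⟩ := B.nonempty_edge 0
  obtain ⟨z, -⟩ := B.exists_path_edge 0 e
  exact ⟨z⟩

variable {B}

/-- The vertex of a path at level `n`. -/
def Path.vert (x : B.Path) (n : ℕ) : B.V n := B.s n (x.1 n)

theorem exists_vert_eq (m : ℕ) (w : B.V m) : ∃ x : B.Path, x.vert m = w := by
  obtain ⟨e, he⟩ := B.s_surjective m w
  obtain ⟨z, hz⟩ := B.exists_path_edge m e
  exact ⟨z, by rw [Path.vert, hz, he]⟩

theorem Path.vert_zero (x : B.Path) : x.vert 0 = B.root := B.eq_root _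

/-- The sequence of the first `n` edges of a path. -/
def Path.pre (n : ℕ) (x : B.Path) : ∀ i : Fin n, B.E i := fun i => x.1 i

theorem Path.pre_eq_iff {n : ℕ} {x y : B.Path} : x.pre n = y.pre n ↔ ∀ i < n, x.1 i = y.1 i :=
  ⟨fun h i hi => congrFun h ⟨i, hi⟩, fun h => funext fun i => h i i.2⟩

theorem mem_cylinder_iff {x y : B.Path} {n : ℕ} : y ∈ B.cylinder x n ↔ y.pre n = x.pre n :=
  Path.pre_eq_iff.symm

theorem cylinder_eq_preimage (x : B.Path) (n : ℕ) :
    B.cylinder x n = Path.pre n ⁻¹' {x.pre n} := by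
  ext y; simp [mem_cylinder_iff]

/-- A set of paths that depends on the first `N` edges only. -/
def IsDetermined (N : ℕ) (A : Set B.Path) : Prop :=
  ∀ x y : B.Path, (∀ i < N, x.1 i = y.1 i) → x ∈ A → y ∈ A

theorem IsDetermined.compl {N : ℕ} {A : Set B.Path} (h : IsDetermined N A) :
    IsDetermined N Aᶜ :=
  fun x y hxy hx hy => hx (h y x (fun i hi => (hxy i hi).symm) hy)

theorem isDetermined_cylinder (x : B.Path) {n N : ℕ} (h : n ≤ N) :
    IsDetermined N (B.cylinder x n) :=
  fun _ _ hyz hy i hi => (hyz i (by omega)).symm.trans (hy i hi)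

theorem isOpen_cylinder (x : B.Path) (n : ℕ) : IsOpen (B.cylinder x n) :=
  TopologicalSpace.isOpen_generateFrom_of_mem ⟨x, n, rfl⟩

theorem IsDetermined.isOpen {N : ℕ} {A : Set B.Path} (h : IsDetermined N A) : IsOpen A := by
  have : A = ⋃ x ∈ A, B.cylinder x N := by
    ext y
    simp only [Set.mem_iUnion, exists_prop]
    exact ⟨fun hy => ⟨y, hy, fun _ _ => rfl⟩,
      fun ⟨x, hx, hy⟩ => h x y (fun i hi => (hy i hi).symm) hx⟩
  rw [this]
  exact isOpen_biUnion fun x _ => isOpen_cylinder x N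

theorem IsDetermined.isClopen {N : ℕ} {A : Set B.Path} (h : IsDetermined N A) : IsClopen A :=
  ⟨⟨h.compl.isOpen⟩, h.isOpen⟩

theorem IsDetermined.measurableSet {N : ℕ} {A : Set B.Path} (h : IsDetermined N A) :
    MeasurableSet A :=
  h.isOpen.measurableSet

theorem isClopen_cylinder (x : B.Path) (n : ℕ) : IsClopen (B.cylinder x n) :=
  (isDetermined_cylinder x le_rfl).isClopen

theorem measurableSet_cylinder (x : B.Path) (n : ℕ) : MeasurableSet (B.cylinder x n) :=
  (isDetermined_cylinder x le_rfl).measurableSet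

theorem continuous_of_locally_determined {f : B.Path → B.Path}
    (h : ∀ m, ∃ N, ∀ x y : B.Path, (∀ i < N, x.1 i = y.1 i) → ∀ i < m, (f x).1 i = (f y).1 i) :
    Continuous f := by
  refine continuous_generateFrom_iff.2 ?_
  rintro _ ⟨z, m, rfl⟩
  obtain ⟨N, hN⟩ := h m
  have : IsDetermined N (f ⁻¹' B.cylinder z m) :=
    fun x y hxy hx i hi => (hN x y hxy i hi).symm.trans (hx i hi)
  exact this.isOpen

theorem countable_cylinders (B : BratteliDiagram.{u, v}) :
    {A : Set B.Path | ∃ x n, A = B.cylinder x n}.Countable := by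
  have : {A : Set B.Path | ∃ x n, A = B.cylinder x n} ⊆
      Set.range (fun p : Σ n, ∀ i : Fin n, B.E i => Path.pre p.1 ⁻¹' {p.2}) := by
    rintro _ ⟨x, n, rfl⟩
    exact ⟨⟨n, x.pre n⟩, (cylinder_eq_preimage x n).symm⟩
  exact (Set.countable_range _).mono this

instance : SecondCountableTopology B.Path :=
  ⟨⟨_, countable_cylinders B, rfl⟩⟩

theorem measurableSpace_eq_generateFrom (B : BratteliDiagram.{u, v}) :
    (inferInstance : MeasurableSpace B.Path) =
      MeasurableSpace.generateFrom {A | ∃ x n, A = B.cylinder x n} :=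
  borel_eq_generateFrom_of_subbasis rfl

theorem isPiSystem_cylinders (B : BratteliDiagram.{u, v}) :
    IsPiSystem {A : Set B.Path | ∃ x n, A = B.cylinder x n} := by
  rintro _ ⟨x, n, rfl⟩ _ ⟨y, m, rfl⟩ ⟨z, hz, hz'⟩
  refine ⟨z, max n m, Set.ext fun w =>
    ⟨fun ⟨h, h'⟩ i hi => ?_, fun h => ⟨fun i hi => ?_, fun i hi => ?_⟩⟩⟩
  · rcases lt_max_iff.1 hi with hi | hi
    · rw [h i hi, hz i hi]
    · rw [h' i hi, hz' i hi]
  · rw [h i (lt_max_of_lt_left hi), hz i hi]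
  · rw [h i (lt_max_of_lt_right hi), hz' i hi]

theorem measure_eq_of_isDetermined {μ ν : Measure B.Path} {N : ℕ}
    (h : ∀ x, μ (B.cylinder x N) = ν (B.cylinder x N)) {A : Set B.Path} (hA : IsDetermined N A) :
    μ A = ν A := by
  classical
  have : ∀ n, Fintype (B.E n) := fun n => Fintype.ofFinite _
  have hAp : A = Path.pre N ⁻¹' (Finset.univ.filter (· ∈ Path.pre N '' A) : Finset _) := by
    ext y
    simp only [Set.mem_preimage, Finset.coe_filter, Finset.mem_univ, true_and, Set.mem_ofPred_eq]
    exact ⟨fun hy => ⟨y, hy, rfl⟩, fun ⟨x, hx, hxy⟩ => hA x y (Path.pre_eq_iff.1 hxy) hx⟩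
  have hm : ∀ y : ∀ i : Fin N, B.E i, MeasurableSet (Path.pre N ⁻¹' {y}) := by
    intro y
    refine IsDetermined.measurableSet (N := N) fun x z hxz hx => ?_
    rw [Set.mem_preimage, ← Path.pre_eq_iff.2 hxz]
    exact hx
  rw [hAp, ← sum_measure_preimage_singleton _ fun y _ => hm y,
    ← sum_measure_preimage_singleton _ fun y _ => hm y]
  refine Finset.sum_congr rfl fun y hy => ?_
  obtain ⟨x, -, rfl⟩ := (Finset.mem_filter.1 hy).2
  rw [← cylinder_eq_preimage, h]

/-- Finite measures that agree on all sufficiently long cylinders are equal. -/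
theorem measure_ext {μ ν : Measure B.Path} [IsFiniteMeasure μ] (K : ℕ)
    (h : ∀ x, ∀ n, K ≤ n → μ (B.cylinder x n) = ν (B.cylinder x n)) : μ = ν := by
  refine ext_of_generate_finite _ (measurableSpace_eq_generateFrom B) (isPiSystem_cylinders B) ?_
    (measure_eq_of_isDetermined (h · K le_rfl) fun _ _ _ _ => trivial)
  rintro _ ⟨x, n, rfl⟩
  exact measure_eq_of_isDetermined (N := max K n) (h · _ (le_max_left _ _))
    (isDetermined_cylinder x (le_max_right _ _))

section Compact

local instance (n : ℕ) : TopologicalSpace (B.E n) := ⊥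

local instance (n : ℕ) : DiscreteTopology (B.E n) := ⟨rfl⟩

/-- The path condition involves two consecutive coordinates at a time, hence is closed in the
product of finite discrete spaces. Compactness and the Hausdorff property follow. -/
theorem isClosedEmbedding_val :
    IsClosedEmbedding (fun x : B.Path => (x.1 : ∀ n, B.E n)) := by
  have hcont : Continuous (fun x : B.Path => (x.1 : ∀ n, B.E n)) := by
    refine continuous_pi fun n => continuous_discrete_rng.2 fun e => ?_
    refine IsDetermined.isOpen (N := n + 1) fun x y hxy hx => ?_
    rw [Set.mem_preimage, Set.mem_singleton_iff] at hx ⊢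
    rw [← hx, hxy n (by omega)]
  refine ⟨⟨⟨le_antisymm hcont.le_induced ?_⟩, Subtype.val_injective⟩, ?_⟩
  · refine le_generateFrom ?_
    rintro _ ⟨x, n, rfl⟩
    refine ⟨⋂ i ∈ Finset.range n, (fun y : ∀ n, B.E n => y i) ⁻¹' {x.1 i}, ?_, ?_⟩
    · exact isOpen_biInter_finset fun i _ => (isOpen_discrete _).preimage (continuous_apply i)
    · ext y; simp [cylinder]
  · have : Set.range (fun x : B.Path => (x.1 : ∀ n, B.E n)) =
        ⋂ n, {y | B.r n (y n) = B.s (n + 1) (y (n + 1))} := by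
      ext y
      simp only [Set.mem_range, Set.mem_iInter, Set.mem_ofPred_eq]
      exact ⟨fun ⟨x, hx⟩ n => hx ▸ x.2 n, fun h => ⟨⟨y, h⟩, rfl⟩⟩
    rw [this]
    refine isClosed_iInter fun n => ?_
    have hc : Continuous fun y : ∀ n, B.E n => (y n, y (n + 1)) :=
      (continuous_apply n).prodMk (continuous_apply (n + 1))
    exact (isClosed_discrete {p : B.E n × B.E (n + 1) | B.r n p.1 = B.s (n + 1) p.2}).preimage hc

instance : CompactSpace B.Path := by
  have : ∀ n, Fintype (B.E n) := fun n => Fintype.ofFinite _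
  exact isClosedEmbedding_val.compactSpace

instance : T2Space B.Path := isClosedEmbedding_val.isEmbedding.t2Space

end Compact

/-! ### Exchanging finite prefixes of paths. -/

/-- The edge sequence obtained from `x` by replacing its first `n` edges by `a`. -/
def glue {n : ℕ} (a : ∀ i : Fin n, B.E i) (x : B.Path) (i : ℕ) : B.E i :=
  if h : i < n then a ⟨i, h⟩ else x.1 i

theorem glue_of_lt {n : ℕ} (a : ∀ i : Fin n, B.E i) (x : B.Path) {i : ℕ} (h : i < n) :
    glue a x i = a ⟨i, h⟩ := dif_pos h

theorem glue_of_le {n : ℕ} (a : ∀ i : Fin n, B.E i) (x : B.Path) {i : ℕ} (h : n ≤ i) :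
    glue a x i = x.1 i := dif_neg (by omega)

/-- The condition that an edge sequence is a path. -/
def IsPath (y : ∀ n, B.E n) : Prop := ∀ n, B.r n (y n) = B.s (n + 1) (y (n + 1))

/-- The path with a given edge sequence. -/
def mkPath (y : ∀ n, B.E n) (h : IsPath y) : B.Path := ⟨y, h⟩

theorem isPath_glue_pre {n : ℕ} {x y : B.Path} (h : x.vert n = y.vert n) :
    IsPath (glue (y.pre n) x) := by
  intro i
  rcases lt_trichotomy (i + 1) n with hi | hi | hi
  · rw [glue_of_lt _ _ hi, glue_of_lt _ _ (show i < n by omega)]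
    exact y.2 i
  · subst hi
    rw [glue_of_lt _ _ (Nat.lt_succ_self i), glue_of_le _ _ le_rfl]
    exact (y.2 i).trans h.symm
  · rw [glue_of_le _ _ (show n ≤ i by omega), glue_of_le _ _ (show n ≤ i + 1 by omega)]
    exact x.2 i

theorem glue_congr {n N : ℕ} (a : ∀ i : Fin n, B.E i) {x y : B.Path}
    (h : ∀ i < N, x.1 i = y.1 i) : ∀ i < N, glue a x i = glue a y i := by
  intro i hi
  unfold glue
  split_ifs
  · rfl
  · exact h i hi

/-- Agreement is required up to index `n` inclusive: the compatibility at the junction reads the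
edge just after the prefix. -/
theorem isPath_glue_congr {n : ℕ} (a : ∀ i : Fin n, B.E i) {x y : B.Path}
    (h : ∀ i < n + 1, x.1 i = y.1 i) (hx : IsPath (glue a x)) : IsPath (glue a y) := by
  intro i
  by_cases hi : i < n
  · rw [← glue_congr a h i (by omega), ← glue_congr a h (i + 1) (by omega)]
    exact hx i
  · rw [glue_of_le _ _ (by omega), glue_of_le _ _ (by omega)]
    exact y.2 i

open Classical in
/-- The involution of the path space that exchanges the prefixes `a` and `b` wherever the result
is again a path. -/
noncomputable def swapFun {n : ℕ} (a b : ∀ i : Fin n, B.E i) (x : B.Path) : B.Path :=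
  if h : x.pre n = a ∧ IsPath (glue b x) then mkPath (glue b x) h.2
  else if h : x.pre n = b ∧ IsPath (glue a x) then mkPath (glue a x) h.2
  else x

theorem swapFun_left {n : ℕ} {a b : ∀ i : Fin n, B.E i} {x : B.Path} (h : x.pre n = a)
    (h' : IsPath (glue b x)) : swapFun a b x = mkPath (glue b x) h' := dif_pos ⟨h, h'⟩

theorem swapFun_right {n : ℕ} {a b : ∀ i : Fin n, B.E i} {x : B.Path}
    (hn : ¬(x.pre n = a ∧ IsPath (glue b x))) (h : x.pre n = b) (h' : IsPath (glue a x)) :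
    swapFun a b x = mkPath (glue a x) h' := (dif_neg hn).trans (dif_pos ⟨h, h'⟩)

theorem swapFun_other {n : ℕ} {a b : ∀ i : Fin n, B.E i} {x : B.Path}
    (h : ¬(x.pre n = a ∧ IsPath (glue b x))) (h' : ¬(x.pre n = b ∧ IsPath (glue a x))) :
    swapFun a b x = x := (dif_neg h).trans (dif_neg h')

theorem pre_mkPath_glue {n : ℕ} {a : ∀ i : Fin n, B.E i} {x : B.Path} (h : IsPath (glue a x)) :
    (mkPath (glue a x) h).pre n = a :=
  funext fun i => glue_of_lt a x i.2

theorem glue_mkPath_glue {n : ℕ} {a b : ∀ i : Fin n, B.E i} {x : B.Path} (h : IsPath (glue b x))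
    (hx : x.pre n = a) : glue a (mkPath (glue b x) h) = x.1 := by
  funext i
  by_cases hi : i < n
  · rw [glue_of_lt _ _ hi, ← hx]; rfl
  · rw [glue_of_le _ _ (by omega)]; exact glue_of_le _ _ (by omega)

theorem swapFun_swapFun {n : ℕ} (a b : ∀ i : Fin n, B.E i) (x : B.Path) :
    swapFun a b (swapFun a b x) = x := by
  by_cases h : x.pre n = a ∧ IsPath (glue b x)
  · have h2 := glue_mkPath_glue h.2 h.1
    have h3 := pre_mkPath_glue h.2
    rw [swapFun_left h.1 h.2]
    -- The first branch of `swapFun` has priority, and can apply twice in a row only if `a = b`.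
    by_cases h4 : (mkPath (glue b x) h.2).pre n = a ∧ IsPath (glue b (mkPath (glue b x) h.2))
    · have : a = b := h4.1.symm.trans h3
      subst this
      rw [swapFun_left h4.1 h4.2]
      exact Subtype.ext h2
    · rw [swapFun_right h4 h3 (h2 ▸ x.2)]
      exact Subtype.ext h2
  · by_cases h' : x.pre n = b ∧ IsPath (glue a x)
    · have h2 := glue_mkPath_glue h'.2 h'.1
      rw [swapFun_right h h'.1 h'.2, swapFun_left (pre_mkPath_glue h'.2) (h2 ▸ x.2)]
      exact Subtype.ext h2
    · rw [swapFun_other h h', swapFun_other h h']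

theorem swapFun_of_le {n : ℕ} (a b : ∀ i : Fin n, B.E i) (x : B.Path) {i : ℕ} (hi : n ≤ i) :
    (swapFun a b x).1 i = x.1 i := by
  by_cases h : x.pre n = a ∧ IsPath (glue b x)
  · rw [swapFun_left h.1 h.2]; exact glue_of_le _ _ hi
  · by_cases h' : x.pre n = b ∧ IsPath (glue a x)
    · rw [swapFun_right h h'.1 h'.2]; exact glue_of_le _ _ hi
    · rw [swapFun_other h h']

theorem swapFun_congr {n N : ℕ} (hN : n < N) (a b : ∀ i : Fin n, B.E i) {x y : B.Path}
    (h : ∀ i < N, x.1 i = y.1 i) : ∀ i < N, (swapFun a b x).1 i = (swapFun a b y).1 i := by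
  have hpre : x.pre n = y.pre n := Path.pre_eq_iff.2 fun i hi => h i (by omega)
  have hp : ∀ c : ∀ i : Fin n, B.E i, IsPath (glue c x) ↔ IsPath (glue c y) := fun c =>
    ⟨isPath_glue_congr c fun i hi => h i (by omega),
      isPath_glue_congr c fun i hi => (h i (by omega)).symm⟩
  intro i hi
  by_cases h1 : x.pre n = a ∧ IsPath (glue b x)
  · rw [swapFun_left h1.1 h1.2, swapFun_left (hpre ▸ h1.1) ((hp b).1 h1.2)]
    exact glue_congr b h i hi
  · have h1' := h1
    rw [hpre, hp] at h1'
    by_cases h2 : x.pre n = b ∧ IsPath (glue a x)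
    · rw [swapFun_right h1 h2.1 h2.2, swapFun_right h1' (hpre ▸ h2.1) ((hp a).1 h2.2)]
      exact glue_congr a h i hi
    · have h2' := h2
      rw [hpre, hp] at h2'
      rw [swapFun_other h1 h2, swapFun_other h1' h2', h i hi]

theorem measurable_swapFun {n : ℕ} (a b : ∀ i : Fin n, B.E i) : Measurable (swapFun a b) := by
  refine (continuous_of_locally_determined fun m => ⟨max m (n + 1), fun x y hxy i hi => ?_⟩).measurable
  exact swapFun_congr (by omega) a b hxy i (by omega)

/-- `swapFun` as a Borel automorphism. -/
noncomputable def swap {n : ℕ} (a b : ∀ i : Fin n, B.E i) : B.Path ≃ᵐ B.Path where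
  toFun := swapFun a b
  invFun := swapFun a b
  left_inv := swapFun_swapFun a b
  right_inv := swapFun_swapFun a b
  measurable_toFun := measurable_swapFun a b
  measurable_invFun := measurable_swapFun a b

theorem swap_swap {n : ℕ} (a b : ∀ i : Fin n, B.E i) (x : B.Path) :
    swap a b (swap a b x) = x := swapFun_swapFun a b x

theorem swap_of_le {n : ℕ} (a b : ∀ i : Fin n, B.E i) (x : B.Path) {i : ℕ} (hi : n ≤ i) :
    (swap a b x).1 i = x.1 i := swapFun_of_le a b x hi

theorem swap_mem_cylinder {n N : ℕ} (hN : n < N) (a b : ∀ i : Fin n, B.E i) {x y : B.Path}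
    (h : y ∈ B.cylinder x N) : swap a b y ∈ B.cylinder (swap a b x) N :=
  swapFun_congr hN a b h

theorem tailEquiv_swap {n : ℕ} (a b : ∀ i : Fin n, B.E i) (x : B.Path) :
    B.TailEquiv x (swap a b x) := ⟨n, fun _ hi => (swap_of_le a b x hi).symm⟩

theorem swap_pre_eq {n : ℕ} {x y : B.Path} (h : ∀ i, n ≤ i → x.1 i = y.1 i) :
    swap (x.pre n) (y.pre n) x = y := by
  have hg : glue (y.pre n) x = y.1 := by
    funext i
    by_cases hi : i < n
    · exact glue_of_lt _ _ hi
    · rw [glue_of_le _ _ (by omega), h i (by omega)]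
  have : swapFun (x.pre n) (y.pre n) x = mkPath (glue (y.pre n) x) (hg ▸ y.2) :=
    swapFun_left rfl _
  exact this.trans (Subtype.ext hg)

theorem vert_eq_of_mem_cylinder {x y : B.Path} {n : ℕ} (h : y ∈ B.cylinder x n) :
    y.vert n = x.vert n := by
  cases n with
  | zero => rw [y.vert_zero, x.vert_zero]
  | succ n =>
    unfold Path.vert
    rw [← y.2, ← x.2, h n (Nat.lt_succ_self n)]

theorem Path.vert_succ (x : B.Path) (n : ℕ) : x.vert (n + 1) = B.r n (x.1 n) := (x.2 n).symm

theorem swap_preimage_cylinder {n : ℕ} {x y : B.Path} (h : x.vert n = y.vert n) :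
    swap (x.pre n) (y.pre n) ⁻¹' B.cylinder y n = B.cylinder x n := by
  have key : ∀ z, z ∈ B.cylinder x n → swap (x.pre n) (y.pre n) z ∈ B.cylinder y n := by
    intro z hz
    have hp : IsPath (glue (y.pre n) z) := isPath_glue_pre ((vert_eq_of_mem_cylinder hz).trans h)
    rw [mem_cylinder_iff]
    change Path.pre n (swapFun _ _ z) = _
    rw [swapFun_left (mem_cylinder_iff.1 hz) hp, pre_mkPath_glue]
  have key' : ∀ z, z ∈ B.cylinder y n → swap (x.pre n) (y.pre n) z ∈ B.cylinder x n := by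
    intro z hz
    have hp : IsPath (glue (x.pre n) z) :=
      isPath_glue_pre ((vert_eq_of_mem_cylinder hz).trans h.symm)
    rw [mem_cylinder_iff] at hz ⊢
    change Path.pre n (swapFun _ _ z) = _
    by_cases h' : z.pre n = x.pre n ∧ IsPath (glue (y.pre n) z)
    · rw [swapFun_left h'.1 h'.2, pre_mkPath_glue, ← hz, h'.1]
    · rw [swapFun_right h' hz hp, pre_mkPath_glue]
  ext z
  refine ⟨fun hz => ?_, key z⟩
  simpa only [swap_swap] using key' _ hz

/-! ### Tail invariance in terms of cylinders. -/

/-- The index set of the countable family of all swaps. -/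
abbrev SwapIndex (B : BratteliDiagram.{u, v}) : Type v :=
  Σ n : ℕ, (∀ i : Fin n, B.E i) × (∀ i : Fin n, B.E i)

/-- The countable family of all swaps. -/
noncomputable def swapOf (i : B.SwapIndex) : B.Path ≃ᵐ B.Path := swap i.2.1 i.2.2

theorem swapOf_swapOf (i : B.SwapIndex) (x : B.Path) : swapOf i (swapOf i x) = x :=
  swap_swap _ _ x

theorem tailEquiv_swapOf (i : B.SwapIndex) (x : B.Path) : B.TailEquiv x (swapOf i x) :=
  tailEquiv_swap _ _ x

theorem exists_swapOf_eq {x y : B.Path} (h : B.TailEquiv x y) : ∃ i, swapOf i x = y := by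
  obtain ⟨n, hn⟩ := h
  exact ⟨⟨n, x.pre n, y.pre n⟩, swap_pre_eq hn⟩

theorem TailEquiv.trans' {x y z : B.Path} (h : B.TailEquiv x y) (h' : B.TailEquiv y z) :
    B.TailEquiv x z := by
  obtain ⟨n, hn⟩ := h
  obtain ⟨m, hm⟩ := h'
  exact ⟨max n m, fun i hi => (hn i (by omega)).trans (hm i (by omega))⟩

theorem TailEquiv.symm' {x y : B.Path} (h : B.TailEquiv x y) : B.TailEquiv y x := by
  obtain ⟨n, hn⟩ := h
  exact ⟨n, fun i hi => (hn i hi).symm⟩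

/-- The measure of cylinders of length at most `N` depends on the terminal vertex only. -/
def IsUniform (N : ℕ) (μ : Measure B.Path) : Prop :=
  ∀ n ≤ N, ∀ x y : B.Path, x.vert n = y.vert n → μ (B.cylinder x n) = μ (B.cylinder y n)

theorem IsTailInvariant.isUniform {μ : Measure B.Path} (h : B.IsTailInvariant μ) (N : ℕ) :
    IsUniform N μ := by
  intro n _ x y hxy
  rw [← swap_preimage_cylinder hxy]
  exact (h _ (tailEquiv_swap _ _)).measure_preimage (measurableSet_cylinder y n).nullMeasurableSet

/-- A swap of prefixes of length `n` carries cylinders longer than `n` to cylinders of the same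
length without moving the terminal vertex, and these cylinders determine a finite measure. -/
theorem measurePreserving_swap {μ : Measure B.Path} [IsFiniteMeasure μ]
    (h : ∀ N, IsUniform N μ) (i : B.SwapIndex) : MeasurePreserving (swapOf i) μ μ := by
  obtain ⟨n, a, b⟩ := i
  refine ⟨(swap a b).measurable, ?_⟩
  have : IsFiniteMeasure (Measure.map (swap a b) μ) := inferInstance
  refine measure_ext (n + 1) fun x m hm => ?_
  change Measure.map (swap a b) μ _ = _
  rw [Measure.map_apply (swap a b).measurable (measurableSet_cylinder x m)]
  have : swap a b ⁻¹' B.cylinder x m = B.cylinder (swap a b x) m := by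
    ext y
    refine ⟨fun hy => ?_, fun hy => ?_⟩
    · simpa only [swap_swap] using swap_mem_cylinder (by omega) a b hy
    · simpa only [swap_swap, Set.mem_preimage] using swap_mem_cylinder (by omega) a b hy
  rw [this]
  refine h m m le_rfl _ _ ?_
  unfold Path.vert
  rw [swap_of_le a b x (by omega)]

/-- A countable measurable cover can be refined to a measurable partition. -/
theorem exists_partition {ι X : Type*} [Countable ι] [MeasurableSpace X] (D : ι → Set X)
    (hD : ∀ i, MeasurableSet (D i)) :
    ∃ D' : ι → Set X, (∀ i, MeasurableSet (D' i)) ∧ (∀ i, D' i ⊆ D i) ∧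
      (⋃ i, D' i) = ⋃ i, D i ∧ Pairwise (Function.onFun Disjoint D') := by
  obtain ⟨e⟩ := nonempty_encodable ι
  let o : ι → ℕ := Encodable.encode
  have ho : Function.Injective o := Encodable.encode_injective
  refine ⟨fun i => D i \ ⋃ j ∈ {j | o j < o i}, D j, fun i => ?_, fun i => Set.sdiff_subset, ?_, ?_⟩
  · exact (hD i).diff (MeasurableSet.biUnion (Set.to_countable _) fun j _ => hD j)
  · refine subset_antisymm (Set.iUnion_mono fun i => Set.sdiff_subset) fun x hx => ?_
    obtain ⟨i, hi⟩ := Set.mem_iUnion.1 hx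
    have hne : (o '' {i | x ∈ D i}).Nonempty := ⟨o i, i, hi, rfl⟩
    obtain ⟨j, hj, hj'⟩ := Nat.sInf_mem hne
    refine Set.mem_iUnion.2 ⟨j, hj, fun hmem => ?_⟩
    simp only [Set.mem_iUnion, exists_prop] at hmem
    obtain ⟨l, hl, hl'⟩ := hmem
    have : sInf (o '' {i | x ∈ D i}) ≤ o l := Nat.sInf_le ⟨l, hl', rfl⟩
    rw [← hj'] at this
    exact absurd hl (not_lt.2 this)
  · intro i j hij
    refine Set.disjoint_left.2 fun x hx hx' => ?_
    rcases lt_trichotomy (o i) (o j) with h | h | h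
    · exact hx'.2 (Set.mem_biUnion (show i ∈ {l | o l < o j} from h) hx.1)
    · exact hij (ho h)
    · exact hx.2 (Set.mem_biUnion (show j ∈ {l | o l < o i} from h) hx'.1)

theorem measure_eq_tsum_of_partition {ι X : Type*} [Countable ι] [MeasurableSpace X]
    (μ : Measure X) {D : ι → Set X} (hD : ∀ i, MeasurableSet (D i))
    (hd : Pairwise (Function.onFun Disjoint D)) {t : Set X} (ht : t ⊆ ⋃ i, D i)
    (hm : MeasurableSet t) : μ t = ∑' i, μ (t ∩ D i) := by
  rw [← measure_iUnion (fun i j hij => ((hd hij).mono Set.inter_subset_right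
    Set.inter_subset_right)) fun i => hm.inter (hD i), ← Set.inter_iUnion,
    Set.inter_eq_left.2 ht]

/-- Countably many swaps realise the whole tail relation. The space is therefore partitioned into
Borel pieces on each of which `T` coincides with a single swap, and the swaps preserve the measure.
-/
theorem isTailInvariant_of_isUniform {μ : Measure B.Path} [IsFiniteMeasure μ]
    (h : ∀ N, IsUniform N μ) : B.IsTailInvariant μ := by
  intro T hT
  obtain ⟨D, hDm, hDs, hDu, hDd⟩ := exists_partition
    (fun i : B.SwapIndex => {x | T x = swapOf i x})
    fun i => measurableSet_eq_fun T.measurable (swapOf i).measurable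
  have hu : (⋃ i, D i) = Set.univ := by
    rw [hDu]
    refine Set.eq_univ_of_forall fun x => Set.mem_iUnion.2 ?_
    obtain ⟨i, hi⟩ := exists_swapOf_eq (hT x)
    exact ⟨i, hi.symm⟩
  refine ⟨T.measurable, Measure.ext fun A hA => ?_⟩
  rw [Measure.map_apply T.measurable hA,
    measure_eq_tsum_of_partition μ hDm hDd (hu ▸ Set.subset_univ _) (T.measurable hA),
    measure_eq_tsum_of_partition μ (D := fun i => T.symm ⁻¹' D i)
      (fun i => T.symm.measurable (hDm i)) (fun i j hij => (hDd hij).preimage T.symm)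
      (t := A) (by rw [← Set.preimage_iUnion, hu]; exact Set.subset_univ _) hA]
  refine tsum_congr fun i => ?_
  rw [← (measurePreserving_swap h i).measure_preimage
    ((hA.inter (T.symm.measurable (hDm i))).nullMeasurableSet)]
  congr 1
  ext x
  simp only [Set.mem_inter_iff, Set.mem_preimage]
  constructor
  · rintro ⟨hx, hxD⟩
    have := hDs i hxD
    rw [Set.mem_ofPred_eq] at this
    rw [← this]
    exact ⟨hx, by simpa using hxD⟩
  -- The point `T.symm (swapOf i x)` lies in `D i`, where `T` is the swap; injectivity of the swap
  -- identifies it with `x`.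
  · rintro ⟨hx, hxD⟩
    have := hDs i hxD
    rw [Set.mem_ofPred_eq, T.apply_symm_apply] at this
    have hx' : swapOf i x = T x := by
      have h2 := congrArg (swapOf i) this
      rw [swapOf_swapOf, swapOf_swapOf] at h2
      rw [← T.symm_apply_eq, ← h2]
    rw [hx'] at hx hxD
    exact ⟨hx, by simpa using hxD⟩

theorem isTailInvariant_iff {μ : Measure B.Path} [IsFiniteMeasure μ] :
    B.IsTailInvariant μ ↔ ∀ N, IsUniform N μ :=
  ⟨fun h N => h.isUniform N, isTailInvariant_of_isUniform⟩

/-! ### Saturated sets and mutual singularity of ergodic measures. -/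

/-- A set that is a union of tail equivalence classes. -/
def IsSaturated (A : Set B.Path) : Prop := ∀ x y, B.TailEquiv x y → (x ∈ A ↔ y ∈ A)

theorem IsSaturated.compl {A : Set B.Path} (h : IsSaturated A) : IsSaturated Aᶜ :=
  fun x y hxy => not_congr (h x y hxy)

/-- Distinct ergodic measures are separated by a saturated set. -/
theorem exists_separating {μ ν : Measure B.Path} (hμ : μ ∈ B.ergodicMeasures)
    (hν : ν ∈ B.ergodicMeasures) (hne : μ ≠ ν) :
    ∃ S, MeasurableSet S ∧ IsSaturated S ∧ μ Sᶜ = 0 ∧ ν S = 0 := by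
  obtain ⟨hμp, hμi, hμe⟩ := hμ
  obtain ⟨hνp, hνi, hνe⟩ := hν
  obtain ⟨s, hs, hs1, hs2⟩ := hahn_decomposition μ ν
  have hm : ∀ i : B.SwapIndex, MeasurableSet (swapOf i ⁻¹' s) :=
    fun i => (swapOf i).measurable hs
  -- The saturation of the Hahn set, on which ergodicity can be used.
  let S : Set B.Path := ⋃ i : B.SwapIndex, swapOf i ⁻¹' s
  have hSm : MeasurableSet S := MeasurableSet.iUnion hm
  have hSmem : ∀ x, x ∈ S ↔ ∃ y ∈ s, B.TailEquiv x y := by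
    intro x
    simp only [S, Set.mem_iUnion, Set.mem_preimage]
    refine ⟨fun ⟨i, hi⟩ => ⟨_, hi, tailEquiv_swapOf i x⟩, fun ⟨y, hy, hxy⟩ => ?_⟩
    obtain ⟨i, rfl⟩ := exists_swapOf_eq hxy
    exact ⟨i, hy⟩
  have hSs : IsSaturated S := by
    have : ∀ x y, B.TailEquiv x y → x ∈ S → y ∈ S := by
      intro x y hxy hx
      obtain ⟨z, hz, hxz⟩ := (hSmem x).1 hx
      exact (hSmem y).2 ⟨z, hz, hxy.symm'.trans' hxz⟩
    exact fun x y hxy => ⟨this x y hxy, this y x hxy.symm'⟩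
  have hsS : s ⊆ S := fun x hx => (hSmem x).2 ⟨x, hx, 0, fun _ _ => rfl⟩
  -- The inequality spreads from `s` to its saturation: pieces of `t` are moved into `s` by swaps,
  -- which preserve both measures.
  have h1 : ∀ t, MeasurableSet t → t ⊆ S → ν t ≤ μ t := by
    intro t ht htS
    obtain ⟨D, hDm, hDs, hDu, hDd⟩ := exists_partition _ hm
    have htD : t ⊆ ⋃ i, D i := hDu ▸ htS
    rw [measure_eq_tsum_of_partition μ hDm hDd htD ht,
      measure_eq_tsum_of_partition ν hDm hDd htD ht]
    refine ENNReal.tsum_le_tsum fun i => ?_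
    have hn := ht.inter (hDm i)
    rw [← (hμi _ (tailEquiv_swapOf i)).measure_preimage hn.nullMeasurableSet,
      ← (hνi _ (tailEquiv_swapOf i)).measure_preimage hn.nullMeasurableSet]
    refine hs1 _ ((swapOf i).measurable hn) fun x hx => ?_
    have := hDs i hx.2
    rwa [Set.mem_preimage, swapOf_swapOf] at this
  have h2 : ∀ t, MeasurableSet t → t ⊆ Sᶜ → μ t ≤ ν t := fun t ht htS =>
    hs2 t ht (htS.trans (Set.compl_subset_compl.2 hsS))
  -- Unless `S` separates the measures, both vanish on `S` or both on its complement. One then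
  -- dominates the other, so the two probability measures coincide.
  rcases hμe S hSm hSs with hμS | hμS
  · have hνS : ν S = 0 := le_antisymm (hμS ▸ h1 S hSm subset_rfl) bot_le
    refine absurd ?_ hne
    refine Measure.eq_of_le_of_isProbabilityMeasure (Measure.le_iff.2 fun t ht => ?_)
    rw [← measure_inter_add_sdiff t hSm (μ := μ), ← measure_inter_add_sdiff t hSm (μ := ν),
      measure_mono_null Set.inter_subset_right hμS, measure_mono_null Set.inter_subset_right hνS]
    gcongr 0 + ?_
    exact h2 _ (ht.diff hSm) fun x hx => hx.2
  · rcases hνe S hSm hSs with hνS | hνS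
    · exact ⟨S, hSm, hSs, hμS, hνS⟩
    · refine absurd ?_ hne.symm
      refine Measure.eq_of_le_of_isProbabilityMeasure (Measure.le_iff.2 fun t ht => ?_)
      rw [← measure_inter_add_sdiff t hSm (μ := μ), ← measure_inter_add_sdiff t hSm (μ := ν),
        measure_mono_null (s := t \ S) (fun x hx => hx.2) hμS,
        measure_mono_null (s := t \ S) (fun x hx => hx.2) hνS]
      gcongr ?_ + 0
      exact h1 _ (ht.inter hSm) Set.inter_subset_right

theorem IsSaturated.preimage_eq {A : Set B.Path} (hA : IsSaturated A) {T : B.Path ≃ᵐ B.Path}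
    (hT : ∀ x, B.TailEquiv x (T x)) : T ⁻¹' A = A :=
  Set.ext fun x => (hA x (T x) (hT x)).symm

theorem IsTailInvariant.cond {μ : Measure B.Path} (h : B.IsTailInvariant μ) {A : Set B.Path}
    (hA : MeasurableSet A) (hAs : IsSaturated A) :
    B.IsTailInvariant (ProbabilityTheory.cond μ A) := by
  intro T hT
  refine ⟨T.measurable, Measure.ext fun t ht => ?_⟩
  rw [Measure.map_apply T.measurable ht, ProbabilityTheory.cond_apply hA,
    ProbabilityTheory.cond_apply hA]
  nth_rw 2 [← hAs.preimage_eq hT]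
  rw [← Set.preimage_inter, (h T hT).measure_preimage (hA.inter ht).nullMeasurableSet]

/-! ### Masses of cylinders. -/

/-- A path through a given vertex. -/
noncomputable def pathTo (n : ℕ) (w : B.V n) : B.Path := (exists_vert_eq n w).choose

theorem vert_pathTo (n : ℕ) (w : B.V n) : (pathTo n w).vert n = w := (exists_vert_eq n w).choose_spec

/-- The measure of a cylinder with terminal vertex `w` at level `n`. -/
noncomputable def mass (μ : Measure B.Path) (n : ℕ) (w : B.V n) : ℝ :=
  μ.real (B.cylinder (pathTo n w) n)

theorem mass_nonneg (μ : Measure B.Path) (n : ℕ) (w : B.V n) : 0 ≤ mass μ n w :=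
  measureReal_nonneg

theorem IsUniform.real_cylinder {μ : Measure B.Path} {N n : ℕ} (h : IsUniform N μ) (hn : n ≤ N)
    (x : B.Path) : μ.real (B.cylinder x n) = mass μ n (x.vert n) := by
  rw [mass, Measure.real, Measure.real, h n hn x _ (vert_pathTo n _).symm]

theorem inter_edge_eq_cylinder (x : B.Path) (n : ℕ) (e : B.E n) (he : B.s n e = x.vert n) :
    ∃ z : B.Path, z.vert (n + 1) = B.r n e ∧
      B.cylinder x n ∩ {y | y.1 n = e} = B.cylinder z (n + 1) := by
  obtain ⟨y, hy⟩ := B.exists_path_edge n e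
  have hyx : y.vert n = x.vert n := by rw [Path.vert, hy, he]
  have hz : (mkPath _ (isPath_glue_pre hyx)).1 n = e := (glue_of_le _ _ le_rfl).trans hy
  have hzi : ∀ i < n, (mkPath _ (isPath_glue_pre hyx)).1 i = x.1 i :=
    fun i hi => glue_of_lt (x.pre n) y hi
  refine ⟨mkPath _ (isPath_glue_pre hyx), ?_, ?_⟩
  · rw [Path.vert_succ, hz]
  · ext w
    refine ⟨fun ⟨h1, h2⟩ i hi => ?_, fun h => ⟨fun i hi => ?_, ?_⟩⟩
    · rcases Nat.lt_succ_iff_lt_or_eq.1 hi with hi | rfl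
      · rw [h1 i hi, hzi i hi]
      · rw [hz]; exact h2
    · rw [h i (by omega), hzi i hi]
    · exact (h n (Nat.lt_succ_self n)).trans hz

/-- A cylinder is split according to its next edge. -/
theorem mass_eq_sum {μ : Measure B.Path} [IsFiniteMeasure μ] {N n : ℕ} (h : IsUniform N μ)
    (hn : n + 1 ≤ N) (w : B.V n) :
    mass μ n w = ∑ v, (B.incidence n v w : ℝ) * mass μ (n + 1) v := by
  classical
  have : Fintype (B.E n) := Fintype.ofFinite _
  have hm : ∀ e : B.E n, MeasurableSet {y : B.Path | y.1 n = e} := fun e =>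
    IsDetermined.measurableSet (N := n + 1) fun x z hxz hx => (hxz n (by omega)).symm.trans hx
  set x := pathTo n w with hx
  have h1 : mass μ n w = ∑ e : B.E n, μ.real (B.cylinder x n ∩ {y | y.1 n = e}) := by
    rw [← measureReal_biUnion_finset]
    · rw [mass]
      congr 1
      ext y
      simp [x]
    · intro e _ e' _ hee'
      exact Set.disjoint_left.2 fun y hy hy' => hee' (hy.2.symm.trans hy'.2)
    · exact fun e _ => (measurableSet_cylinder x n).inter (hm e)
  have h2 : ∀ e : B.E n, μ.real (B.cylinder x n ∩ {y | y.1 n = e}) =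
      ∑ v, if B.r n e = v ∧ B.s n e = w then mass μ (n + 1) v else 0 := by
    intro e
    by_cases he : B.s n e = w
    · obtain ⟨z, hz, hz'⟩ := inter_edge_eq_cylinder x n e (he.trans (vert_pathTo n w).symm)
      rw [hz', h.real_cylinder hn, hz]
      simp [he]
    · have : B.cylinder x n ∩ {y | y.1 n = e} = ∅ := by
        refine Set.eq_empty_of_forall_notMem fun y hy => he ?_
        have h3 := vert_eq_of_mem_cylinder hy.1
        rw [hx, vert_pathTo] at h3
        rw [← h3, Path.vert, hy.2]
      simp [this, he]
  rw [h1, Finset.sum_congr rfl fun e _ => h2 e, Finset.sum_comm]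
  refine Finset.sum_congr rfl fun v _ => ?_
  rw [← Finset.sum_filter, Finset.sum_const, nsmul_eq_mul, incidence, Matrix.of_apply,
    Nat.card_eq_fintype_card, Fintype.card_subtype]

/-! ### Finitely supported approximations and their limits. -/

/-- The finite set of paths that agree with `y` from level `n` on. -/
def tailSet (y : B.Path) (n : ℕ) : Set B.Path := {x | ∀ i, n ≤ i → x.1 i = y.1 i}

theorem finite_tailSet (y : B.Path) (n : ℕ) : (tailSet y n).Finite := by
  refine Set.Finite.of_injOn (f := Path.pre n) (t := Set.univ) (fun _ _ => trivial) ?_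
    Set.finite_univ
  intro x hx z hz hxz
  refine Subtype.ext (funext fun i => ?_)
  by_cases hi : i < n
  · exact Path.pre_eq_iff.1 hxz i hi
  · rw [hx i (by omega), hz i (by omega)]

/-- The uniform measure on the paths that agree with `y` from level `n` on. -/
noncomputable def tailMeasure (y : B.Path) (n : ℕ) : Measure B.Path :=
  ProbabilityTheory.uniformOn (tailSet y n)

instance (y : B.Path) (n : ℕ) : IsProbabilityMeasure (tailMeasure y n) :=
  ProbabilityTheory.isProbabilityMeasure_uniformOn (finite_tailSet y n) ⟨y, fun _ _ => rfl⟩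

/-- Swapping prefixes no longer than `n` permutes the finite set of paths with the given tail. -/
theorem isUniform_tailMeasure (y : B.Path) (n : ℕ) : IsUniform n (tailMeasure y n) := by
  intro m hm x x' hx
  have hs : swap (x.pre m) (x'.pre m) ⁻¹' tailSet y n = tailSet y n := by
    ext z
    refine forall₂_congr fun i hi => ?_
    rw [swap_of_le _ _ _ (by omega)]
  have hmeas := (finite_tailSet y n).measurableSet
  rw [← swap_preimage_cylinder hx, tailMeasure, ProbabilityTheory.uniformOn,
    ProbabilityTheory.cond_apply hmeas, ProbabilityTheory.cond_apply hmeas]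
  nth_rw 2 [← hs]
  rw [← Set.preimage_inter, Measure.count_apply
    ((swap _ _).measurable (hmeas.inter (measurableSet_cylinder x' m))),
    Measure.count_apply (hmeas.inter (measurableSet_cylinder x' m)),
    ← MeasurableEquiv.image_symm, (swap _ _).symm.injective.encard_image]

theorem mass_tailMeasure_eq_zero (y : B.Path) (n : ℕ) {w : B.V n} (hw : w ≠ y.vert n) :
    mass (tailMeasure y n) n w = 0 := by
  have hmeas := (finite_tailSet y n).measurableSet
  have : tailSet y n ∩ B.cylinder (pathTo n w) n = ∅ := by
    refine Set.eq_empty_of_forall_notMem fun x hx => hw ?_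
    rw [← vert_pathTo n w, ← vert_eq_of_mem_cylinder hx.2, Path.vert, hx.1 n le_rfl, Path.vert]
  rw [mass, Measure.real, tailMeasure, ProbabilityTheory.uniformOn,
    ProbabilityTheory.cond_apply hmeas, this]
  simp

/-- Limits of probability measures that are uniform on longer and longer cylinders. -/
theorem exists_limit (U : Ultrafilter ℕ) (hU : (U : Filter ℕ) ≤ atTop)
    (μ : ℕ → Measure B.Path) (hp : ∀ n, IsProbabilityMeasure (μ n))
    (hμ : ∀ n, IsUniform n (μ n)) :
    ∃ ν : Measure B.Path, IsProbabilityMeasure ν ∧ B.IsTailInvariant ν ∧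
      ∀ n w, Tendsto (fun N => mass (μ N) n w) U (𝓝 (mass ν n w)) := by
  let ρ : ℕ → ProbabilityMeasure B.Path := fun n => ⟨μ n, hp n⟩
  obtain ⟨ν, -, hν⟩ := isCompact_univ.ultrafilter_le_nhds (U.map ρ) (by simp)
  have hcyl : ∀ x n, Tendsto (fun N => μ N (B.cylinder x n)) U
      (𝓝 ((ν : Measure B.Path) (B.cylinder x n))) := by
    intro x n
    -- Cylinders are clopen, so weak convergence passes to their measures.
    refine ProbabilityMeasure.tendsto_measure_of_null_frontier_of_tendsto' (μs := ρ) hν ?_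
    rw [(isClopen_cylinder x n).frontier_eq, measure_empty]
  refine ⟨ν, inferInstance, isTailInvariant_iff.2 fun _ n _ x y hxy => ?_, fun n w => ?_⟩
  · refine tendsto_nhds_unique ((hcyl x n).congr' ?_) (hcyl y n)
    filter_upwards [hU (eventually_ge_atTop n)] with N hN
    exact hμ N n hN x y hxy
  · exact (ENNReal.tendsto_toReal (measure_ne_top _ _)).comp (hcyl _ n)

end BratteliDiagram

/-! ### Determinant bounds and infinite products. -/

namespace Matrix

/-- The absolute value of a determinant is at most the product of the `ℓ¹` norms of the rows. -/
theorem abs_det_le_prod_sum_abs {n : Type*} [Fintype n] [DecidableEq n] (A : Matrix n n ℝ) :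
    |A.det| ≤ ∏ i, ∑ j, |A i j| := by
  classical
  -- The product of row sums expands over all maps of indices; the determinant uses only the
  -- permutations among them.
  rw [Finset.prod_univ_sum, ← det_transpose, det_apply]
  calc |∑ σ : Equiv.Perm n, Equiv.Perm.sign σ • ∏ i, Aᵀ (σ i) i|
      ≤ ∑ σ : Equiv.Perm n, |Equiv.Perm.sign σ • ∏ i, Aᵀ (σ i) i| := Finset.abs_sum_le_sum_abs _ _
    _ = ∑ σ : Equiv.Perm n, ∏ i, |A i (σ i)| := by
        refine Finset.sum_congr rfl fun σ _ => ?_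
        rcases Int.units_eq_one_or (Equiv.Perm.sign σ) with h | h <;>
          simp [h, Finset.abs_prod, Units.smul_def]
    _ = ∑ p ∈ Finset.univ.image (fun σ : Equiv.Perm n => (σ : n → n)), ∏ i, |A i (p i)| :=
        by
        rw [Finset.sum_image fun σ _ τ _ h => DFunLike.coe_injective h]
    _ ≤ _ := by
        refine Finset.sum_le_sum_of_subset_of_nonneg ?_
          fun p _ _ => Finset.prod_nonneg fun i _ => abs_nonneg _
        intro p _
        simp

theorem det_ne_zero_of_rank_eq {n : Type*} [Fintype n] [DecidableEq n] (A : Matrix n n ℝ)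
    (h : A.rank = Fintype.card n) : A.det ≠ 0 := by
  rw [← isUnit_iff_ne_zero, ← isUnit_iff_isUnit_det, ← linearIndependent_rows_iff_isUnit,
    linearIndependent_iff_card_eq_finrank_span, ← h, rank_eq_finrank_span_row]
  rfl

end Matrix

theorem antitone_prod_range_of_le_one {a : ℕ → ℝ} (h0 : ∀ n, 0 ≤ a n) (h1 : ∀ n, a n ≤ 1) :
    Antitone fun N => ∏ n ∈ Finset.range N, a n := by
  refine antitone_nat_of_succ_le fun N => ?_
  rw [Finset.prod_range_succ]
  exact mul_le_of_le_one_right (Finset.prod_nonneg fun n _ => h0 n) (h1 N)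

/-- For numbers in `(0, 1]`, the partial products have a positive limit as soon as they are
bounded below by a positive number. -/
theorem exists_tendsto_prod_of_le {a : ℕ → ℝ} (h0 : ∀ n, 0 < a n) (h1 : ∀ n, a n ≤ 1) {δ : ℝ}
    (hδ : 0 < δ) (h : ∀ N, δ ≤ ∏ n ∈ Finset.range N, a n) :
    ∃ c, 0 < c ∧ Tendsto (fun N => ∏ n ∈ Finset.range N, a n) atTop (𝓝 c) := by
  have hanti := antitone_prod_range_of_le_one (fun n => (h0 n).le) h1
  have := tendsto_atTop_ciInf hanti ⟨δ, by rintro _ ⟨N, rfl⟩; exact h N⟩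
  exact ⟨_, hδ.trans_le (le_ciInf h), this⟩

/-- One direction is `log x ≤ x - 1`, the other summability of `log (1 + x)` for summable `x`.
Positivity of every factor makes the logarithms legitimate. -/
theorem exists_tendsto_prod_iff_summable {a : ℕ → ℝ} (h0 : ∀ n, 0 < a n) (h1 : ∀ n, a n ≤ 1) :
    (∃ c, 0 < c ∧ Tendsto (fun N => ∏ n ∈ Finset.range N, a n) atTop (𝓝 c)) ↔
      Summable fun n => 1 - a n := by
  constructor
  · rintro ⟨c, hc, hlim⟩
    have hanti := antitone_prod_range_of_le_one (fun n => (h0 n).le) h1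
    refine summable_of_sum_range_le (c := -Real.log c) (fun n => sub_nonneg.2 (h1 n)) fun N => ?_
    have h2 : c ≤ ∏ n ∈ Finset.range N, a n := hanti.le_of_tendsto hlim N
    have h3 : Real.log c ≤ ∑ n ∈ Finset.range N, Real.log (a n) := by
      rw [← Real.log_prod fun n _ => (h0 n).ne']
      exact Real.log_le_log hc h2
    have h4 : ∑ n ∈ Finset.range N, Real.log (a n) ≤ ∑ n ∈ Finset.range N, (a n - 1) :=
      Finset.sum_le_sum fun n _ => Real.log_le_sub_one_of_pos (h0 n)
    rw [Finset.sum_sub_distrib] at h4 ⊢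
    linarith
  · intro h
    have h2 : Summable fun n => Real.log (a n) := by
      have := Real.summable_log_one_add_of_summable h.neg
      refine this.congr fun n => ?_
      congr 1
      ring
    refine ⟨Real.exp (∑' n, Real.log (a n)), Real.exp_pos _, ?_⟩
    refine ((Real.continuous_exp.tendsto _).comp h2.hasSum.tendsto_sum_nat).congr fun N => ?_
    rw [Function.comp, Real.exp_sum]
    exact Finset.prod_congr rfl fun n _ => Real.exp_log (h0 n)

/-! ### Stochastic incidence matrices. -/

namespace BratteliDiagram

open Matrix

variable {B : BratteliDiagram.{u, v}} {k : ℕ}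

/-- The incidence matrix between the vertex sets of levels `n + 1` and `n + 2`, divided by the
row sum. -/
noncomputable def stochMatrix (σ : ∀ n, B.V (n + 1) ≃ Fin k) (r : ℕ → ℕ) (n : ℕ) :
    Matrix (Fin k) (Fin k) ℝ :=
  Matrix.of fun i j => (B.incidence (n + 1) ((σ (n + 1)).symm i) ((σ n).symm j) : ℝ) / r (n + 1)

theorem stochMatrix_nonneg (σ : ∀ n, B.V (n + 1) ≃ Fin k) (r : ℕ → ℕ) (n : ℕ) (i j : Fin k) :
    0 ≤ stochMatrix σ r n i j := by
  rw [stochMatrix, of_apply]; positivity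

/-- The product of the stochastic incidence matrices of indices below `n`. -/
noncomputable def stochProd (σ : ∀ n, B.V (n + 1) ≃ Fin k) (r : ℕ → ℕ) :
    ℕ → Matrix (Fin k) (Fin k) ℝ
  | 0 => 1
  | n + 1 => stochMatrix σ r n * stochProd σ r n

theorem det_stochProd (σ : ∀ n, B.V (n + 1) ≃ Fin k) (r : ℕ → ℕ) (N : ℕ) :
    (stochProd σ r N).det = ∏ n ∈ Finset.range N, (stochMatrix σ r n).det := by
  induction N with
  | zero => simp [stochProd]
  | succ N ih => rw [stochProd, det_mul, ih, Finset.prod_range_succ, mul_comm]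

theorem sum_stochMatrix {σ : ∀ n, B.V (n + 1) ≃ Fin k} {r : ℕ → ℕ}
    (hr : ∀ n, 1 ≤ n → 2 ≤ r n)
    (hrow : ∀ n, 1 ≤ n → ∀ i : B.V (n + 1), ∑ j : B.V n, B.incidence n i j = r n)
    (n : ℕ) (i : Fin k) : ∑ j, stochMatrix σ r n i j = 1 := by
  have h := hrow (n + 1) (by omega) ((σ (n + 1)).symm i)
  have h2 := hr (n + 1) (by omega)
  simp only [stochMatrix, of_apply]
  rw [← Finset.sum_div, div_eq_one_iff_eq (by positivity), ← h, Nat.cast_sum]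
  exact (σ n).symm.sum_comp fun j => (B.incidence (n + 1) ((σ (n + 1)).symm i) j : ℝ)

theorem det_stochMatrix {σ : ∀ n, B.V (n + 1) ≃ Fin k} {r : ℕ → ℕ}
    (hr : ∀ n, 1 ≤ n → 2 ≤ r n)
    (hrow : ∀ n, 1 ≤ n → ∀ i : B.V (n + 1), ∑ j : B.V n, B.incidence n i j = r n)
    (hk : 2 ≤ k) (n : ℕ) :
    (stochMatrix σ r n).det = B.zDet σ n (r (n + 1)) := by
  -- Adding all the other columns to the last leaves the determinant unchanged and, the row sums
  -- being one, produces the column of ones.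
  have h := det_updateCol_sum (stochMatrix σ r n) ⟨k - 1, by omega⟩ fun _ => 1
  rw [one_smul] at h
  rw [← h, zDet]
  congr 1
  ext i j
  by_cases hj : (j : ℕ) + 1 = k
  · have : j = ⟨k - 1, by omega⟩ := Fin.ext (by simp; omega)
    rw [this, updateCol_self]
    simp [sum_stochMatrix hr hrow, show k - 1 + 1 = k by omega]
  · rw [updateCol_ne (fun h => hj (by rw [h]; simp; omega))]
    simp [stochMatrix, hj]

theorem abs_det_stochMatrix_le {σ : ∀ n, B.V (n + 1) ≃ Fin k} {r : ℕ → ℕ}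
    (hr : ∀ n, 1 ≤ n → 2 ≤ r n)
    (hrow : ∀ n, 1 ≤ n → ∀ i : B.V (n + 1), ∑ j : B.V n, B.incidence n i j = r n)
    (n : ℕ) : |(stochMatrix σ r n).det| ≤ 1 := by
  refine (abs_det_le_prod_sum_abs _).trans (Finset.prod_le_one (fun i _ => by positivity) ?_)
  intro i _
  simp_rw [abs_of_nonneg (stochMatrix_nonneg σ r n i _)]
  rw [sum_stochMatrix hr hrow]

theorem stochProd_mulVec_one {σ : ∀ n, B.V (n + 1) ≃ Fin k} {r : ℕ → ℕ}
    (hr : ∀ n, 1 ≤ n → 2 ≤ r n)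
    (hrow : ∀ n, 1 ≤ n → ∀ i : B.V (n + 1), ∑ j : B.V n, B.incidence n i j = r n)
    (n : ℕ) : stochProd σ r n *ᵥ 1 = 1 := by
  induction n with
  | zero => simp [stochProd]
  | succ n ih =>
    rw [stochProd, ← mulVec_mulVec, ih]
    ext i
    simp [mulVec, dotProduct, sum_stochMatrix hr hrow]

theorem det_stochMatrix_ne_zero {σ : ∀ n, B.V (n + 1) ≃ Fin k} {r : ℕ → ℕ}
    (hr : ∀ n, 1 ≤ n → 2 ≤ r n)
    (hrank : ∀ n, 1 ≤ n → ((B.incidence n).map (fun a : ℕ => (a : ℝ))).rank = k) (n : ℕ) :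
    (stochMatrix σ r n).det ≠ 0 := by
  have h2 := hr (n + 1) (by omega)
  have h : stochMatrix σ r n = (r (n + 1) : ℝ)⁻¹ •
      (((B.incidence (n + 1)).map (fun a : ℕ => (a : ℝ))).submatrix (σ (n + 1)).symm (σ n).symm) := by
    ext i j
    simp [stochMatrix, div_eq_inv_mul]
  rw [h, det_smul]
  refine mul_ne_zero (by positivity) (det_ne_zero_of_rank_eq _ ?_)
  rw [rank_submatrix, hrank _ (by omega), Fintype.card_fin]

theorem det_stochProd_ne_zero {σ : ∀ n, B.V (n + 1) ≃ Fin k} {r : ℕ → ℕ}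
    (hr : ∀ n, 1 ≤ n → 2 ≤ r n)
    (hrank : ∀ n, 1 ≤ n → ((B.incidence n).map (fun a : ℕ => (a : ℝ))).rank = k) (n : ℕ) :
    (stochProd σ r n).det ≠ 0 := by
  rw [det_stochProd]
  exact Finset.prod_ne_zero_iff.2 fun n _ => det_stochMatrix_ne_zero hr hrank n

/-! ### Mass vectors of invariant measures. -/

/-- The vector of measures of the cylinders that end at level `n + 1`. -/
noncomputable def massVec (σ : ∀ n, B.V (n + 1) ≃ Fin k) (μ : Measure B.Path) (n : ℕ) :
    Fin k → ℝ :=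
  fun j => mass μ (n + 1) ((σ n).symm j)

theorem massVec_nonneg (σ : ∀ n, B.V (n + 1) ≃ Fin k) (μ : Measure B.Path) (n : ℕ) (j : Fin k) :
    0 ≤ massVec σ μ n j := mass_nonneg _ _ _

/-- The product of the row sums up to level `n`. -/
noncomputable def rowProd (r : ℕ → ℕ) (n : ℕ) : ℝ := ∏ m ∈ Finset.range n, (r (m + 1) : ℝ)

theorem rowProd_pos {r : ℕ → ℕ} (hr : ∀ n, 1 ≤ n → 2 ≤ r n) (n : ℕ) : 0 < rowProd r n := by
  refine Finset.prod_pos fun m _ => ?_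
  have := hr (m + 1) (by omega)
  positivity

theorem massVec_succ {σ : ∀ n, B.V (n + 1) ≃ Fin k} {r : ℕ → ℕ} (hr : ∀ n, 1 ≤ n → 2 ≤ r n)
    {μ : Measure B.Path} [IsFiniteMeasure μ] {N n : ℕ} (h : IsUniform N μ) (hn : n + 2 ≤ N) :
    massVec σ μ n = ((r (n + 1) : ℝ) • massVec σ μ (n + 1)) ᵥ* stochMatrix σ r n := by
  have h2 := hr (n + 1) (by omega)
  have h3 : (r (n + 1) : ℝ) ≠ 0 := by positivity
  ext j
  rw [massVec, mass_eq_sum h hn, ← (σ (n + 1)).symm.sum_comp, vecMul, dotProduct]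
  refine Finset.sum_congr rfl fun i _ => ?_
  rw [Pi.smul_apply, smul_eq_mul, stochMatrix, of_apply, massVec]
  field_simp

theorem massVec_zero_eq {σ : ∀ n, B.V (n + 1) ≃ Fin k} {r : ℕ → ℕ} (hr : ∀ n, 1 ≤ n → 2 ≤ r n)
    {μ : Measure B.Path} [IsFiniteMeasure μ] {N n : ℕ} (h : IsUniform N μ) (hn : n + 1 ≤ N) :
    massVec σ μ 0 = (rowProd r n • massVec σ μ n) ᵥ* stochProd σ r n := by
  induction n with
  | zero => simp [rowProd, stochProd]
  | succ n ih =>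
    rw [ih (by omega), massVec_succ hr h hn, stochProd, ← vecMul_vecMul, rowProd, rowProd,
      Finset.prod_range_succ, mul_smul, ← smul_vecMul]

/-- The all-ones vector is fixed by a row-stochastic matrix, so the renormalised total mass is the
same at every level. -/
theorem sum_massVec {σ : ∀ n, B.V (n + 1) ≃ Fin k} {r : ℕ → ℕ} (hr : ∀ n, 1 ≤ n → 2 ≤ r n)
    (hrow : ∀ n, 1 ≤ n → ∀ i : B.V (n + 1), ∑ j : B.V n, B.incidence n i j = r n)
    {μ : Measure B.Path} [IsFiniteMeasure μ] {N n : ℕ} (h : IsUniform N μ) (hn : n + 1 ≤ N) :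
    ∑ j, massVec σ μ 0 j = ∑ j, rowProd r n * massVec σ μ n j := by
  rw [← dotProduct_one, massVec_zero_eq hr h hn, ← dotProduct_mulVec,
    stochProd_mulVec_one hr hrow, dotProduct_one]
  rfl

/-- The number of edges from the root to the vertex of level one labelled `j`. -/
noncomputable def rootDegree (σ : ∀ n, B.V (n + 1) ≃ Fin k) (j : Fin k) : ℝ :=
  B.incidence 0 ((σ 0).symm j) B.root

theorem one_le_rootDegree (σ : ∀ n, B.V (n + 1) ≃ Fin k) (j : Fin k) : 1 ≤ rootDegree σ j := by
  obtain ⟨e, he⟩ := B.r_surjective 0 ((σ 0).symm j)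
  have : Nonempty {e : B.E 0 // B.r 0 e = (σ 0).symm j ∧ B.s 0 e = B.root} :=
    ⟨⟨e, he, B.eq_root _⟩⟩
  rw [rootDegree, incidence, of_apply, Nat.one_le_cast]
  exact Nat.card_pos

/-- This is the total mass. The edges at the root are not subject to the row-sum condition, so the
level-one coordinates need not add up to one; the next two bounds measure the discrepancy. -/
theorem sum_rootDegree_mul_massVec (σ : ∀ n, B.V (n + 1) ≃ Fin k) {μ : Measure B.Path}
    [IsProbabilityMeasure μ] {N : ℕ} (h : IsUniform N μ) (hN : 1 ≤ N) :
    ∑ j, rootDegree σ j * massVec σ μ 0 j = 1 := by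
  have h1 := mass_eq_sum h (n := 0) hN B.root
  rw [← (σ 0).symm.sum_comp] at h1
  refine h1.symm.trans ?_
  have : B.cylinder (pathTo 0 B.root) 0 = Set.univ :=
    Set.eq_univ_of_forall fun _ _ hi => absurd hi (Nat.not_lt_zero _)
  rw [mass, this, probReal_univ]

theorem sum_massVec_le_one (σ : ∀ n, B.V (n + 1) ≃ Fin k) {μ : Measure B.Path}
    [IsProbabilityMeasure μ] {N : ℕ} (h : IsUniform N μ) (hN : 1 ≤ N) :
    ∑ j, massVec σ μ 0 j ≤ 1 := by
  rw [← sum_rootDegree_mul_massVec σ h hN]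
  exact Finset.sum_le_sum fun j _ =>
    le_mul_of_one_le_left (massVec_nonneg σ μ 0 j) (one_le_rootDegree σ j)

theorem one_le_mul_sum_massVec (σ : ∀ n, B.V (n + 1) ≃ Fin k) {μ : Measure B.Path}
    [IsProbabilityMeasure μ] {N : ℕ} (h : IsUniform N μ) (hN : 1 ≤ N) :
    1 ≤ (∑ j, rootDegree σ j) * ∑ j, massVec σ μ 0 j := by
  rw [← sum_rootDegree_mul_massVec σ h hN, Finset.mul_sum]
  refine Finset.sum_le_sum fun j _ => mul_le_mul_of_nonneg_right ?_ (massVec_nonneg σ μ 0 j)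
  exact Finset.single_le_sum (f := rootDegree σ)
    (fun i _ => zero_le_one.trans (one_le_rootDegree σ i)) (Finset.mem_univ j)

/-- An invariant measure is determined by the masses at level one. -/
theorem eq_of_massVec_eq {σ : ∀ n, B.V (n + 1) ≃ Fin k} {r : ℕ → ℕ} (hr : ∀ n, 1 ≤ n → 2 ≤ r n)
    (hrank : ∀ n, 1 ≤ n → ((B.incidence n).map (fun a : ℕ => (a : ℝ))).rank = k)
    {μ ν : Measure B.Path} [IsFiniteMeasure μ] [IsFiniteMeasure ν]
    (hμ : ∀ N, IsUniform N μ) (hν : ∀ N, IsUniform N ν)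
    (h : massVec σ μ 0 = massVec σ ν 0) : μ = ν := by
  have hn : ∀ n, massVec σ μ n = massVec σ ν n := by
    intro n
    rw [massVec_zero_eq hr (hμ (n + 1)) le_rfl, massVec_zero_eq hr (hν (n + 1)) le_rfl] at h
    have hu : IsUnit (stochProd σ r n) := by
      rw [isUnit_iff_isUnit_det, isUnit_iff_ne_zero]
      exact det_stochProd_ne_zero hr hrank n
    exact smul_right_injective _ (rowProd_pos hr n).ne' (vecMul_injective_iff_isUnit.2 hu h)
  refine measure_ext 1 fun x n hn1 => ?_
  obtain ⟨n, rfl⟩ : ∃ m, n = m + 1 := ⟨n - 1, by omega⟩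
  rw [← measureReal_eq_measureReal_iff, (hμ _).real_cylinder le_rfl,
    (hν _).real_cylinder le_rfl]
  simpa [massVec] using congrFun (hn n) (σ n (x.vert (n + 1)))

/-! ### Linear independence and ergodicity. -/

/-- A nonnegative linear combination of measures. -/
noncomputable def combination {ι : Type*} [Fintype ι] (t : ι → ℝ) (μ : ι → Measure B.Path) :
    Measure B.Path :=
  ∑ i, (ENNReal.ofReal (t i)) • μ i

instance {ι : Type*} [Fintype ι] (t : ι → ℝ) (μ : ι → Measure B.Path)
    [∀ i, IsFiniteMeasure (μ i)] : IsFiniteMeasure (combination t μ) := by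
  have : ∀ i, IsFiniteMeasure (ENNReal.ofReal (t i) • μ i) := fun i =>
    Measure.smul_finite _ ENNReal.ofReal_ne_top
  unfold combination
  infer_instance

theorem combination_apply {ι : Type*} [Fintype ι] (t : ι → ℝ) (μ : ι → Measure B.Path)
    (A : Set B.Path) : combination t μ A = ∑ i, ENNReal.ofReal (t i) * μ i A := by
  simp [combination]

theorem isUniform_combination {ι : Type*} [Fintype ι] (t : ι → ℝ) {μ : ι → Measure B.Path}
    {N : ℕ} (h : ∀ i, IsUniform N (μ i)) : IsUniform N (combination t μ) := by
  intro n hn x y hxy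
  simp_rw [combination_apply, h _ n hn x y hxy]

theorem massVec_combination {ι : Type*} [Fintype ι] (σ : ∀ n, B.V (n + 1) ≃ Fin k) (t : ι → ℝ)
    (μ : ι → Measure B.Path) [∀ i, IsFiniteMeasure (μ i)] (n : ℕ) :
    massVec σ (combination t μ) n = ∑ i, max (t i) 0 • massVec σ (μ i) n := by
  ext j
  simp only [massVec, mass, Measure.real, combination_apply, Finset.sum_apply, Pi.smul_apply,
    smul_eq_mul]
  rw [ENNReal.toReal_sum fun i _ => ENNReal.mul_ne_top ENNReal.ofReal_ne_top (measure_ne_top _ _)]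
  simp [ENNReal.toReal_mul, ENNReal.toReal_ofReal']

/-- Distinct ergodic measures have linearly independent masses at level one. -/
theorem linearIndependent_massVec {σ : ∀ n, B.V (n + 1) ≃ Fin k} {r : ℕ → ℕ}
    (hr : ∀ n, 1 ≤ n → 2 ≤ r n)
    (hrank : ∀ n, 1 ≤ n → ((B.incidence n).map (fun a : ℕ => (a : ℝ))).rank = k)
    {ι : Type*} [Fintype ι] {μ : ι → Measure B.Path} (hinj : Function.Injective μ)
    (hμ : ∀ i, μ i ∈ B.ergodicMeasures) :
    LinearIndependent ℝ fun i => massVec σ (μ i) 0 := by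
  have hp : ∀ i, IsProbabilityMeasure (μ i) := fun i => (hμ i).1
  have hu : ∀ N i, IsUniform N (μ i) := fun N i => isTailInvariant_iff.1 (hμ i).2.1 N
  rw [Fintype.linearIndependent_iff]
  intro c hc i
  -- Because `ENNReal.ofReal` truncates at zero, these are the combinations with the positive and
  -- the negative parts of `c`. The relation equates their level-one vectors, hence the measures.
  have heq : combination c μ = combination (-c) μ := by
    refine eq_of_massVec_eq (σ := σ) hr hrank (fun N => isUniform_combination _ (hu N))
      (fun N => isUniform_combination _ (hu N)) ?_
    rw [massVec_combination, massVec_combination, ← sub_eq_zero, ← Finset.sum_sub_distrib, ← hc]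
    refine Finset.sum_congr rfl fun i _ => ?_
    rw [← sub_smul]
    congr 1
    rw [Pi.neg_apply]
    exact max_zero_sub_max_neg_zero_eq_self (c i)
  choose S hSm hSs hS1 hS0 using fun (j : ι) (hj : j ≠ i) =>
    exists_separating (hμ i) (hμ j) (fun h => hj (hinj h).symm)
  -- `A` carries `μ i` and is null for all the others, so evaluating at `A` isolates the coefficient
  -- of index `i`.
  let A : Set B.Path := ⋂ (j : ι) (hj : j ≠ i), S j hj
  have hAm : MeasurableSet A := MeasurableSet.iInter fun j => MeasurableSet.iInter fun hj => hSm j hj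
  have hA0 : ∀ j ≠ i, μ j A = 0 := fun j hj =>
    measure_mono_null (Set.iInter₂_subset j hj) (hS0 j hj)
  have hA1 : μ i A = 1 := by
    rw [← prob_compl_eq_zero_iff hAm]
    simp only [A, Set.compl_iInter]
    exact measure_iUnion_null fun j => measure_iUnion_null fun hj => hS1 j hj
  have hval : ∀ t : ι → ℝ, combination t μ A = ENNReal.ofReal (t i) := by
    intro t
    rw [combination_apply, Finset.sum_eq_single i (fun j _ hj => by rw [hA0 j hj, mul_zero])
      (by simp), hA1, mul_one]
  have h := hval c
  rw [heq, hval, Pi.neg_apply] at h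
  rcases le_total (c i) 0 with h0 | h0
  · rw [ENNReal.ofReal_of_nonpos h0, ENNReal.ofReal_eq_zero] at h
    linarith
  · rw [ENNReal.ofReal_of_nonpos (neg_nonpos.2 h0), eq_comm, ENNReal.ofReal_eq_zero] at h
    linarith

theorem IsUniform.mono {N M : ℕ} {μ : Measure B.Path} (h : IsUniform N μ) (hM : M ≤ N) :
    IsUniform M μ := fun n hn => h n (hn.trans hM)

theorem massVec_cond {σ : ∀ n, B.V (n + 1) ≃ Fin k} (μ : Measure B.Path) [IsProbabilityMeasure μ]
    {A : Set B.Path} (hA : MeasurableSet A) (n : ℕ) :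
    massVec σ μ n = μ.real A • massVec σ (ProbabilityTheory.cond μ A) n +
      μ.real Aᶜ • massVec σ (ProbabilityTheory.cond μ Aᶜ) n := by
  ext j
  have h := congrArg ENNReal.toReal (ProbabilityTheory.cond_add_cond_compl_eq (μ := μ)
    (t := B.cylinder (pathTo (n + 1) ((σ n).symm j)) (n + 1)) hA)
  rw [ENNReal.toReal_add (ENNReal.mul_ne_top (measure_ne_top _ _) (measure_ne_top _ _))
    (ENNReal.mul_ne_top (measure_ne_top _ _) (measure_ne_top _ _)), ENNReal.toReal_mul,
    ENNReal.toReal_mul] at h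
  simp only [massVec, mass, Pi.add_apply, Pi.smul_apply, smul_eq_mul, Measure.real]
  rw [← h]
  ring

/-- Linearly independent invariant measures whose nonnegative combinations are all the invariant
measures are ergodic. -/
theorem mem_ergodicMeasures_of_cone {σ : ∀ n, B.V (n + 1) ≃ Fin k} {r : ℕ → ℕ}
    (hr : ∀ n, 1 ≤ n → 2 ≤ r n)
    (hrank : ∀ n, 1 ≤ n → ((B.incidence n).map (fun a : ℕ => (a : ℝ))).rank = k)
    {ι : Type*} [Fintype ι] {μ : ι → Measure B.Path} (hp : ∀ i, IsProbabilityMeasure (μ i))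
    (hi : ∀ i, B.IsTailInvariant (μ i)) (hli : LinearIndependent ℝ fun i => massVec σ (μ i) 0)
    (hcone : ∀ α : Measure B.Path, IsProbabilityMeasure α → B.IsTailInvariant α →
      ∃ t : ι → ℝ, (∀ i, 0 ≤ t i) ∧ massVec σ α 0 = ∑ i, t i • massVec σ (μ i) 0) (i : ι) :
    μ i ∈ B.ergodicMeasures := by
  classical
  refine ⟨hp i, hi i, fun A hA hAs => ?_⟩
  by_contra! hne
  have hAs' : IsSaturated A := hAs
  have hpα := ProbabilityTheory.cond_isProbabilityMeasure hne.1
  have hpβ := ProbabilityTheory.cond_isProbabilityMeasure hne.2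
  have hiα := (hi i).cond hA hAs'
  obtain ⟨t, ht, htα⟩ := hcone _ hpα hiα
  obtain ⟨s, hs, hsβ⟩ := hcone _ hpβ ((hi i).cond hA.compl hAs'.compl)
  have ha : 0 < (μ i).real A := ENNReal.toReal_pos hne.1 (measure_ne_top _ _)
  have hb : 0 ≤ (μ i).real Aᶜ := measureReal_nonneg
  have hdec := massVec_cond (σ := σ) (μ i) hA 0
  rw [htα, hsβ, Finset.smul_sum, Finset.smul_sum, ← Finset.sum_add_distrib] at hdec
  have hzero : ∑ j, ((μ i).real A * t j + (μ i).real Aᶜ * s j - if j = i then 1 else 0) •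
      massVec σ (μ j) 0 = 0 := by
    simp only [sub_smul, add_smul, mul_smul, Finset.sum_sub_distrib, ite_smul, one_smul, zero_smul,
      Finset.sum_ite_eq', Finset.mem_univ, if_true]
    rw [sub_eq_zero, ← hdec]
  have hcoef := Fintype.linearIndependent_iff.1 hli _ hzero
  -- Extremality: in the decomposition of `μ i` into its two conditionings, nonnegative terms add up
  -- to zero off `i`.
  have htj : ∀ j, j ≠ i → t j = 0 := by
    intro j hj
    have h := hcoef j
    rw [if_neg hj, sub_zero] at h
    have h1 := mul_nonneg ha.le (ht j)
    have h2 := mul_nonneg hb (hs j)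
    exact (mul_eq_zero.1 (by linarith : (μ i).real A * t j = 0)).resolve_left ha.ne'
  rw [Finset.sum_eq_single i (fun j _ hj => by rw [htj j hj, zero_smul]) (by simp)] at htα
  have hu : ∀ N, IsUniform N (μ i) := isTailInvariant_iff.1 (hi i)
  have huα : ∀ N, IsUniform N (ProbabilityTheory.cond (μ i) A) := isTailInvariant_iff.1 hiα
  -- Both measures have total mass one. The conditioned measure then equals `μ i`, yet it does not
  -- charge the complement of `A`.
  have hti : t i = 1 := by
    have h1 := sum_rootDegree_mul_massVec σ (huα 1) le_rfl
    have h2 := sum_rootDegree_mul_massVec σ (hu 1) le_rfl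
    rw [htα] at h1
    simp only [Pi.smul_apply, smul_eq_mul, mul_left_comm _ (t i)] at h1
    rwa [← Finset.mul_sum, h2, mul_one] at h1
  rw [hti, one_smul] at htα
  have heq := eq_of_massVec_eq hr hrank huα hu htα
  refine hne.2 ?_
  rw [← heq, ProbabilityTheory.cond_apply hA, Set.inter_compl_self, measure_empty, mul_zero]

/-! ### Counting ergodic measures. -/

theorem exists_injective_of_le_encard {X : Type*} {s : Set X} {n : ℕ} (h : (n : ℕ∞) ≤ s.encard) :
    ∃ f : Fin n → X, Function.Injective f ∧ ∀ i, f i ∈ s := by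
  obtain ⟨t, hts, ht⟩ := Set.exists_subset_encard_eq h
  have hfin : t.Finite := Set.finite_of_encard_eq_coe ht
  have hcard : hfin.toFinset.card = n := by
    rw [hfin.encard_eq_coe_toFinset_card] at ht
    exact_mod_cast ht
  refine ⟨fun i => (hfin.toFinset.equivFinOfCardEq hcard).symm i, fun i j hij => ?_, fun i => ?_⟩
  · exact (hfin.toFinset.equivFinOfCardEq hcard).symm.injective (Subtype.ext hij)
  · exact hts (hfin.mem_toFinset.1 ((hfin.toFinset.equivFinOfCardEq hcard).symm i).2)

theorem encard_ergodicMeasures_le (σ : ∀ n, B.V (n + 1) ≃ Fin k) {r : ℕ → ℕ}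
    (hr : ∀ n, 1 ≤ n → 2 ≤ r n)
    (hrank : ∀ n, 1 ≤ n → ((B.incidence n).map (fun a : ℕ => (a : ℝ))).rank = k) :
    B.ergodicMeasures.encard ≤ k := by
  by_contra! h
  obtain ⟨f, hf, hfm⟩ := exists_injective_of_le_encard (n := k + 1)
    (by rw [Nat.cast_add, Nat.cast_one]; exact Order.add_one_le_of_lt h)
  have := (linearIndependent_massVec (σ := σ) hr hrank hf hfm).fintype_card_le_finrank
  rw [Fintype.card_fin, Module.finrank_fin_fun] at this
  omega

/-- If there are `k` ergodic measures, the determinants are bounded away from zero. -/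
theorem exists_le_abs_det_stochProd (σ : ∀ n, B.V (n + 1) ≃ Fin k) {r : ℕ → ℕ}
    (hr : ∀ n, 1 ≤ n → 2 ≤ r n)
    (hrow : ∀ n, 1 ≤ n → ∀ i : B.V (n + 1), ∑ j : B.V n, B.incidence n i j = r n)
    (hrank : ∀ n, 1 ≤ n → ((B.incidence n).map (fun a : ℕ => (a : ℝ))).rank = k)
    (h : (k : ℕ∞) ≤ B.ergodicMeasures.encard) :
    ∃ δ : ℝ, 0 < δ ∧ ∀ N, δ ≤ |(stochProd σ r N).det| := by
  obtain ⟨μ, hinj, hμ⟩ := exists_injective_of_le_encard h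
  have hp : ∀ i, IsProbabilityMeasure (μ i) := fun i => (hμ i).1
  have hu : ∀ N i, IsUniform N (μ i) := fun N i => isTailInvariant_iff.1 (hμ i).2.1 N
  have hli := linearIndependent_massVec (σ := σ) hr hrank hinj hμ
  let P : Matrix (Fin k) (Fin k) ℝ := Matrix.of fun i => massVec σ (μ i) 0
  have hP : P.det ≠ 0 := by
    rw [← isUnit_iff_ne_zero, ← isUnit_iff_isUnit_det, ← linearIndependent_rows_iff_isUnit]
    exact hli
  refine ⟨|P.det|, abs_pos.2 hP, fun N => ?_⟩
  -- The same measures seen at level `N + 1`, renormalised: nonnegative rows with sum at most one.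
  let Q : Matrix (Fin k) (Fin k) ℝ := Matrix.of fun i => rowProd r N • massVec σ (μ i) N
  have hPQ : P = Q * stochProd σ r N := by
    ext i j
    exact congrFun (massVec_zero_eq (σ := σ) hr (hu (N + 1) i) le_rfl) j
  have hQ : |Q.det| ≤ 1 := by
    refine (abs_det_le_prod_sum_abs Q).trans (Finset.prod_le_one (fun i _ => by positivity) ?_)
    intro i _
    have hQi : ∀ j, |Q i j| = rowProd r N * massVec σ (μ i) N j := fun j =>
      abs_of_nonneg (mul_nonneg (rowProd_pos hr N).le (massVec_nonneg _ _ _ _))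
    simp_rw [hQi]
    rw [← sum_massVec hr hrow (hu (N + 1) i) le_rfl]
    exact sum_massVec_le_one σ (hu 1 i) le_rfl
  rw [hPQ, det_mul, abs_mul]
  exact mul_le_of_le_one_left (abs_nonneg _) hQ

/-- If the determinants are bounded away from zero, there are `k` ergodic measures. -/
theorem le_encard_ergodicMeasures (σ : ∀ n, B.V (n + 1) ≃ Fin k) {r : ℕ → ℕ}
    (hr : ∀ n, 1 ≤ n → 2 ≤ r n)
    (hrow : ∀ n, 1 ≤ n → ∀ i : B.V (n + 1), ∑ j : B.V n, B.incidence n i j = r n)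
    (hrank : ∀ n, 1 ≤ n → ((B.incidence n).map (fun a : ℕ => (a : ℝ))).rank = k)
    {δ : ℝ} (hδ : 0 < δ) (hdet : ∀ N, δ ≤ |(stochProd σ r N).det|) :
    (k : ℕ∞) ≤ B.ergodicMeasures.encard := by
  rcases Nat.eq_zero_or_pos k with rfl | hk
  · simp
  let U : Ultrafilter ℕ := hyperfilter ℕ
  have hU : (U : Filter ℕ) ≤ atTop := Nat.hyperfilter_le_atTop
  let ν : ℕ → Fin k → Measure B.Path := fun n i =>
    tailMeasure (pathTo (n + 1) ((σ n).symm i)) (n + 1)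
  have hνp : ∀ n i, IsProbabilityMeasure (ν n i) := fun n i => inferInstance
  have hνu : ∀ n i, IsUniform (n + 1) (ν n i) := fun n i => isUniform_tailMeasure _ _
  choose μ hμp hμi hμlim using fun i => exists_limit U hU (fun n => ν n i) (fun n => hνp n i)
    fun n => (hνu n i).mono (Nat.le_succ n)
  let H : ℝ := ∑ j, rootDegree σ j
  have hH : 0 < H := by
    have : Nonempty (Fin k) := ⟨⟨0, hk⟩⟩
    exact Finset.sum_pos (fun j _ => zero_lt_one.trans_le (one_le_rootDegree σ j))
      Finset.univ_nonempty
  let c : ℕ → Fin k → ℝ := fun n i => rowProd r n * massVec σ (ν n i) n i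
  have hν0 : ∀ n i j, j ≠ i → massVec σ (ν n i) n j = 0 := by
    intro n i j hij
    refine mass_tailMeasure_eq_zero _ _ fun h => hij ?_
    rw [vert_pathTo] at h
    exact (σ n).symm.injective h
  have hc : ∀ n i, ∑ j, massVec σ (ν n i) 0 j = c n i := by
    intro n i
    rw [sum_massVec hr hrow (hνu n i) le_rfl]
    exact Finset.sum_eq_single i (fun j _ hj => by rw [hν0 n i j hj, mul_zero]) (by simp)
  -- This uniform lower bound keeps the scaling factors `c n i` from collapsing the determinant in
  -- the limit.
  have hcH : ∀ n i, 1 ≤ H * c n i := by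
    intro n i
    rw [← hc]
    exact one_le_mul_sum_massVec σ (hνu n i) (by omega)
  have hcpos : ∀ n i, 0 < c n i := fun n i =>
    pos_of_mul_pos_right (zero_lt_one.trans_le (hcH n i)) hH.le
  let P : ℕ → Matrix (Fin k) (Fin k) ℝ := fun n => Matrix.of fun i => massVec σ (ν n i) 0
  have hP : ∀ n, P n = diagonal (c n) * stochProd σ r n := by
    intro n
    ext i j
    rw [diagonal_mul]
    have h := congrFun (massVec_zero_eq (σ := σ) hr (hνu n i) le_rfl) j
    refine h.trans ?_
    rw [vecMul, dotProduct, Finset.sum_eq_single i]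
    · rfl
    · intro l _ hl
      rw [Pi.smul_apply, hν0 n i l hl, smul_zero, zero_mul]
    · simp
  let P' : Matrix (Fin k) (Fin k) ℝ := Matrix.of fun i => massVec σ (μ i) 0
  have hPlim : Tendsto P U (𝓝 P') :=
    tendsto_pi_nhds.2 fun i => tendsto_pi_nhds.2 fun j => hμlim i _ _
  have hdetlim : Tendsto (fun n => |(P n).det|) U (𝓝 |P'.det|) :=
    ((continuous_id.matrix_det.tendsto P').comp hPlim).abs
  have hP' : P'.det ≠ 0 := by
    have hb : ∀ n, H⁻¹ ^ k * δ ≤ |(P n).det| := by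
      intro n
      rw [hP, det_mul, det_diagonal, abs_mul, Finset.abs_prod]
      refine mul_le_mul ?_ (hdet n) hδ.le (Finset.prod_nonneg fun _ _ => abs_nonneg _)
      have hpow : H⁻¹ ^ k = ∏ _i : Fin k, H⁻¹ := by simp
      rw [hpow]
      refine Finset.prod_le_prod (fun _ _ => (inv_pos.2 hH).le) fun i _ => ?_
      rw [abs_of_pos (hcpos n i), inv_le_iff_one_le_mul₀' hH]
      exact hcH n i
    have h := ge_of_tendsto hdetlim (Eventually.of_forall hb)
    have h0 : 0 < H⁻¹ ^ k * δ := by positivity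
    exact abs_pos.1 (h0.trans_le h)
  have hli : LinearIndependent ℝ fun i => massVec σ (μ i) 0 := by
    rw [← isUnit_iff_ne_zero, ← isUnit_iff_isUnit_det, ← linearIndependent_rows_iff_isUnit] at hP'
    exact hP'
  have hcone : ∀ α : Measure B.Path, IsProbabilityMeasure α → B.IsTailInvariant α →
      ∃ t : Fin k → ℝ, (∀ i, 0 ≤ t i) ∧ massVec σ α 0 = ∑ i, t i • massVec σ (μ i) 0 := by
    intro α hα hαi
    have hαu : ∀ N, IsUniform N α := isTailInvariant_iff.1 hαi
    -- The coordinates of `α` in the rows of `P n`. They lie in `[0, H]`, so they converge along the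
    -- ultrafilter to nonnegative coordinates in the limit rows.
    let t : ℕ → Fin k → ℝ := fun n i => rowProd r n * massVec σ α n i / c n i
    have ht0 : ∀ n i, 0 ≤ rowProd r n * massVec σ α n i := fun n i =>
      mul_nonneg (rowProd_pos hr n).le (massVec_nonneg _ _ _ _)
    have ht : ∀ n, t n ∈ Set.Icc (0 : Fin k → ℝ) (fun _ => H) := by
      refine fun n => ⟨fun i => div_nonneg (ht0 n i) (hcpos n i).le, fun i => ?_⟩
      rw [div_le_iff₀ (hcpos n i)]
      refine le_trans ?_ (hcH n i)
      refine le_trans ?_ (sum_massVec_le_one σ (hαu 1) le_rfl)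
      rw [sum_massVec hr hrow (hαu (n + 1)) le_rfl]
      exact Finset.single_le_sum (f := fun i => rowProd r n * massVec σ α n i)
        (fun i _ => ht0 n i) (Finset.mem_univ i)
    obtain ⟨t', ht', htlim⟩ := isCompact_Icc.ultrafilter_le_nhds (U.map t)
      (le_principal_iff.2 (Filter.mem_map.2 (Eventually.of_forall ht)))
    have htP : ∀ n, massVec σ α 0 = t n ᵥ* P n := by
      intro n
      rw [hP, ← vecMul_vecMul, massVec_zero_eq hr (hαu (n + 1)) le_rfl]
      congr 1
      ext i
      rw [vecMul_diagonal, div_mul_cancel₀ _ (hcpos n i).ne']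
      rfl
    refine ⟨t', ht'.1, ?_⟩
    have hlim : Tendsto (fun n => t n ᵥ* P n) U (𝓝 (t' ᵥ* P')) := by
      have hcont : Continuous fun x : (Fin k → ℝ) × Matrix (Fin k) (Fin k) ℝ => x.1 ᵥ* x.2 :=
        continuous_fst.matrix_vecMul continuous_snd
      have htl : Tendsto t U (𝓝 t') := htlim
      exact (hcont.tendsto (t', P')).comp (htl.prodMk_nhds hPlim)
    have heq : massVec σ α 0 = t' ᵥ* P' :=
      tendsto_nhds_unique (tendsto_const_nhds.congr htP) hlim
    rw [heq, vecMul_eq_sum]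
    rfl
  have hinj : Function.Injective μ := fun i j hij =>
    hli.injective (congrArg (fun ρ => massVec σ ρ 0) hij)
  calc (k : ℕ∞) = (Set.range μ).encard := by
        rw [← Set.image_univ, hinj.encard_image, Set.encard_univ]; simp
    _ ≤ _ := Set.encard_le_encard (Set.range_subset_iff.2
        (mem_ergodicMeasures_of_cone hr hrank hμp hμi hli hcone))

end BratteliDiagram

/-! ### The criterion. -/

theorem mainTheorem2 (B : BratteliDiagram.{u, v}) (k : ℕ) (hk : 2 ≤ k)
    (σ : ∀ n, B.V (n + 1) ≃ Fin k) (r : ℕ → ℕ) (hr : ∀ n, 1 ≤ n → 2 ≤ r n)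
    (hrow : ∀ n, 1 ≤ n → ∀ i : B.V (n + 1), ∑ j : B.V n, B.incidence n i j = r n)
    (hrank : ∀ n, 1 ≤ n → ((B.incidence n).map (fun a : ℕ => (a : ℝ))).rank = k) :
    (B.ergodicMeasures.encard = (k : ℕ∞) ↔
      ∃ c : ℝ, 0 < c ∧
        Tendsto (fun N : ℕ => ∏ n ∈ Finset.range N, |B.zDet σ n (r (n + 1))|) atTop (𝓝 c)) ∧
    ((∃ c : ℝ, 0 < c ∧
        Tendsto (fun N : ℕ => ∏ n ∈ Finset.range N, |B.zDet σ n (r (n + 1))|) atTop (𝓝 c)) ↔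
      Summable (fun n : ℕ => 1 - |B.zDet σ n (r (n + 1))|)) := by
  have hz0 : ∀ n, 0 < |B.zDet σ n (r (n + 1))| := fun n => by
    rw [← BratteliDiagram.det_stochMatrix hr hrow hk]
    exact abs_pos.2 (BratteliDiagram.det_stochMatrix_ne_zero hr hrank n)
  have hz1 : ∀ n, |B.zDet σ n (r (n + 1))| ≤ 1 := fun n => by
    rw [← BratteliDiagram.det_stochMatrix hr hrow hk]
    exact BratteliDiagram.abs_det_stochMatrix_le hr hrow n
  have hprod : ∀ N, |(BratteliDiagram.stochProd σ r N).det| =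
      ∏ n ∈ Finset.range N, |B.zDet σ n (r (n + 1))| := fun N => by
    rw [BratteliDiagram.det_stochProd, Finset.abs_prod]
    exact Finset.prod_congr rfl fun n _ => by rw [BratteliDiagram.det_stochMatrix hr hrow hk]
  refine ⟨⟨fun h => ?_, fun ⟨c, hc, hlim⟩ => ?_⟩, exists_tendsto_prod_iff_summable hz0 hz1⟩
  · obtain ⟨δ, hδ, hle⟩ := BratteliDiagram.exists_le_abs_det_stochProd σ hr hrow hrank h.ge
    exact exists_tendsto_prod_of_le hz0 hz1 hδ fun N => hprod N ▸ hle N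
  · refine le_antisymm (BratteliDiagram.encard_ergodicMeasures_le σ hr hrank)
      (BratteliDiagram.le_encard_ergodicMeasures σ hr hrow hrank hc fun N => ?_)
    rw [hprod]
    exact (antitone_prod_range_of_le_one (fun n => (hz0 n).le) hz1).le_of_tendsto hlim N
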